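/- Let $1\to G\xrightarrow{\ i\ }G'\xrightarrow{\ p\ }G''\to 1$ be a diffeological extension of diffeological groups, that is, a short exact sequence of groups in which $i$ is an induction (injective, with $G$ carrying the diffeology pulled back along $i$) and $p$ is a subduction (smooth and surjective, with every plot of $G''$ lifting locally along $p$ to a plot of $G'$). For a diffeological group $H$ let $EH$ be the join of countably many copies of $H$: the set of sequences $(t_j,h_j)_{j\in\mathbb N}$ with $t_j\in[0,1]$, $h_j\in H$, only finitely many $t_j\neq0$ and $\sum_j t_j=1$, with the subset diffeology of the product, modulo the relation identifying sequences that have the same $t_j$ and the same $h_j$ whenever $t_j\ne0$, with the quotient diffeology. Let $BH=EH/H$ for the action $h\cdot(t_jh_j)=(t_jh_jh^{-1})$, with the quotient diffeology; a smooth homomorphism $\varphi\colon H\to K$ induces the smooth map $B\varphi\colon BH\to BK$, $[t_jh_j]\mapsto[t_j\varphi(h_j)]$. Let $\pi_n(X,x)$ ($n\ge0$) denote the diffeological homotopy groups: the set of smooth path components of the $n$-fold iterated space of smooth loops at $x$ (loop spaces carrying the functional diffeology), pointed by the class of the constant map, and a group under concatenation of loops when $n\ge1$. Then for every base point $x\in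 BG$, with $x'=Bi(x)$ and $x''=Bp(x')$, there are connecting maps $\delta_n\colon\pi_{n+1}(BG'',x'')\to\pi_n(BG,x)$ ($n\ge0$), which are group homomorphisms for $n\ge1$, such that the sequence $$\cdots\to\pi_{n+1}(BG'',x'')\xrightarrow{\delta_n}\pi_n(BG,x)\xrightarrow{(Bi)_*}\pi_n(BG',x')\xrightarrow{(Bp)_*}\pi_n(BG'',x'')\xrightarrow{\delta_{n-1}}\pi_{n-1}(BG,x)\to\cdots\to\pi_0(BG,x)\to\pi_0(BG',x')\to\pi_0(BG'',x'')\to 0$$ is exact (as a sequence of groups in degrees $n\ge1$, and of pointed sets at its end), where surjectivity is meant at the last arrow. -/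

import Mathlib

open scoped ContDiff Topology

noncomputable section

namespace Diffeology

universe u v w

/-! ### Local description of plots -/

section Local

variable {X : Type*} [DiffeologicalSpace X] {n : ℕ}

/-- A map that agrees near every point with some plot is a plot. -/
theorem isPlot_of_eventuallyEq {p : EuclideanSpace ℝ (Fin n) → X}
    (h : ∀ x, ∃ q : EuclideanSpace ℝ (Fin n) → X, IsPlot q ∧ q =ᶠ[𝓝 x] p) : IsPlot p := by
  refine DiffeologicalSpace.locality fun x => ?_
  obtain ⟨q, hq, hqp⟩ := h x
  obtain ⟨s, hs, hso, hxs⟩ := eventually_nhds_iff.1 hqp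
  refine ⟨s, hso, hxs, fun {m f} hf hfs => ?_⟩
  have : p ∘ f = q ∘ f := funext fun y => (hs _ (hf y)).symm
  rw [this]
  exact isPlot_reparam hq hfs

/-- A Euclidean space can be mapped smoothly into a given neighbourhood of a point, by a map that
is the identity near that point. -/
theorem exists_smooth_into {s : Set (EuclideanSpace ℝ (Fin n))} (hs : IsOpen s)
    {x : EuclideanSpace ℝ (Fin n)} (hx : x ∈ s) :
    ∃ f : EuclideanSpace ℝ (Fin n) → EuclideanSpace ℝ (Fin n),
      ContDiff ℝ ∞ f ∧ (∀ y, f y ∈ s) ∧ ∀ᶠ y in 𝓝 x, f y = y := by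
  obtain ⟨ε, hε, hεs⟩ := Metric.isOpen_iff.1 hs x hx
  let χ : ContDiffBump x := ⟨ε / 2, ε, by positivity, by linarith⟩
  refine ⟨fun y => x + χ y • (y - x), ?_, fun y => hεs ?_, ?_⟩
  · exact contDiff_const.add (χ.contDiff.smul (contDiff_id.sub contDiff_const))
  · by_cases hy : y ∈ Metric.ball x ε
    · rw [Metric.mem_ball, dist_eq_norm] at hy ⊢
      rw [add_sub_cancel_left, norm_smul, Real.norm_eq_abs, abs_of_nonneg χ.nonneg]
      calc χ y * ‖y - x‖ ≤ 1 * ‖y - x‖ := by gcongr; exact χ.le_one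
        _ < ε := by rwa [one_mul]
    · have : χ y = 0 := χ.zero_of_le_dist (by simpa using hy)
      simp [this, hε]
  · filter_upwards [χ.eventuallyEq_one] with y hy
    simp [hy]

end Local

/-! ### Products, subsets, quotients and spaces of smooth maps -/

/-- The product diffeology of two diffeological spaces. -/
instance instProd {X : Type*} {Y : Type*} [DiffeologicalSpace X] [DiffeologicalSpace Y] :
    DiffeologicalSpace (X × Y) where
  plots _ := {p | IsPlot (fun x => (p x).1) ∧ IsPlot (fun x => (p x).2)}
  constant_plots _ := ⟨isPlot_const, isPlot_const⟩
  plot_reparam hp hf := ⟨isPlot_reparam hp.1 hf, isPlot_reparam hp.2 hf⟩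
  locality h :=
    ⟨DiffeologicalSpace.locality fun x => by
      obtain ⟨s, hs, hx, h'⟩ := h x
      exact ⟨s, hs, hx, fun hf hfs => (h' hf hfs).1⟩,
    DiffeologicalSpace.locality fun x => by
      obtain ⟨s, hs, hx, h'⟩ := h x
      exact ⟨s, hs, hx, fun hf hfs => (h' hf hfs).2⟩⟩

/-- The product diffeology of a family of diffeological spaces. -/
instance instPi {ι : Type*} {X : ι → Type*} [∀ i, DiffeologicalSpace (X i)] :
    DiffeologicalSpace (∀ i, X i) where
  plots _ := {p | ∀ i, IsPlot (fun x => p x i)}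
  constant_plots _ := fun _ => isPlot_const
  plot_reparam hp hf := fun i => isPlot_reparam (hp i) hf
  locality h := fun i => DiffeologicalSpace.locality fun x => by
    obtain ⟨s, hs, hx, h'⟩ := h x
    exact ⟨s, hs, hx, fun hf hfs => h' hf hfs i⟩

/-- The subset diffeology. -/
instance instSubtype {X : Type*} [DiffeologicalSpace X] {P : X → Prop} :
    DiffeologicalSpace {x : X // P x} where
  plots _ := {p | IsPlot (fun x => (p x).1)}
  constant_plots _ := isPlot_const
  plot_reparam hp hf := isPlot_reparam hp hf
  locality h := DiffeologicalSpace.locality fun x => by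
    obtain ⟨s, hs, hx, h'⟩ := h x
    exact ⟨s, hs, hx, fun hf hfs => h' hf hfs⟩

/-- The quotient diffeology: its plots are the maps that lift locally to plots. -/
instance instQuotient {X : Type*} [DiffeologicalSpace X] {r : Setoid X} :
    DiffeologicalSpace (Quotient r) where
  plots n := {p | ∀ x, ∃ q : EuclideanSpace ℝ (Fin n) → X,
    IsPlot q ∧ ∀ᶠ y in 𝓝 x, Quotient.mk r (q y) = p y}
  constant_plots a := fun _ => by
    obtain ⟨b, rfl⟩ := Quotient.exists_rep a
    exact ⟨fun _ => b, isPlot_const, Filter.Eventually.of_forall fun _ => rfl⟩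
  plot_reparam {n m p f} hp hf := fun x => by
    obtain ⟨q, hq, hqp⟩ := hp (f x)
    exact ⟨q ∘ f, isPlot_reparam hq hf, hf.continuous.continuousAt.eventually hqp⟩
  locality {n p} h := fun x => by
    obtain ⟨s, hs, hx, h'⟩ := h x
    obtain ⟨f, hf, hfs, hfx⟩ := exists_smooth_into hs hx
    obtain ⟨q, hq, hqp⟩ := h' hfs hf x
    refine ⟨q, hq, ?_⟩
    filter_upwards [hqp, hfx] with y hy hy'
    rw [hy, Function.comp_apply, hy']

/-- The set of smooth maps between two diffeological spaces. -/
@[ext]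
structure SmoothMap (X : Type u) (Y : Type v) [DiffeologicalSpace X] [DiffeologicalSpace Y] :
    Type (max u v) where
  /-- The underlying map. -/
  toFun : X → Y
  smooth : DSmooth toFun

section Products

variable {X : Type*} {Y : Type*} {Z : Type*} [DiffeologicalSpace X] [DiffeologicalSpace Y]
  [DiffeologicalSpace Z]

theorem dSmooth_fst : DSmooth (Prod.fst : X × Y → X) := fun _ _ hp => hp.1

theorem dSmooth_snd : DSmooth (Prod.snd : X × Y → Y) := fun _ _ hp => hp.2

theorem DSmooth.prodMk {f : X → Y} {g : X → Z} (hf : DSmooth f) (hg : DSmooth g) :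
    DSmooth (fun x => (f x, g x)) :=
  fun n p hp => ⟨hf n p hp, hg n p hp⟩

/-- The functional diffeology: a family of smooth maps is a plot when the evaluation map of the
family is smooth. -/
instance instSmoothMap : DiffeologicalSpace (SmoothMap X Y) where
  plots n := {p | DSmooth (fun q : EuclideanSpace ℝ (Fin n) × X => (p q.1).toFun q.2)}
  constant_plots f := f.smooth.comp dSmooth_snd
  plot_reparam {n m p f} hp hf := by
    have hp' : DSmooth (fun q : EuclideanSpace ℝ (Fin m) × X => (p q.1).toFun q.2) := hp
    exact hp'.comp ((hf.dSmooth.comp dSmooth_fst).prodMk dSmooth_snd)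
  locality {n p} h := by
    intro m r hr
    refine isPlot_of_eventuallyEq fun y => ?_
    obtain ⟨s, hs, hx, h'⟩ := h (r y).1
    obtain ⟨f, hf, hfs, hfx⟩ := exists_smooth_into hs hx
    have h1 : DSmooth (fun q : EuclideanSpace ℝ (Fin n) × X => ((p ∘ f) q.1).toFun q.2) := h' hfs hf
    refine ⟨_, h1 m r hr, ?_⟩
    have hr1 : Continuous fun z => (r z).1 := (IsPlot.contDiff hr.1).continuous
    filter_upwards [hr1.continuousAt.eventually hfx] with z hz
    simp only [Function.comp_apply, hz]

end Products

/-! ### Path components and homotopy groups -/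

/-- Two smooth maps that agree on a strip around the level set `τ = c` can be glued along it. -/
theorem DSmooth.glue {W : Type*} {X : Type*} [DiffeologicalSpace W] [DiffeologicalSpace X]
    {τ : W → ℝ} (hτ : DSmooth τ) {f g : W → X} (hf : DSmooth f) (hg : DSmooth g) (c : ℝ) {ε : ℝ}
    (hε : 0 < ε) (h : ∀ a, |τ a - c| < ε → f a = g a) :
    DSmooth (fun a => if τ a ≤ c then f a else g a) := by
  intro n p hp
  have hc : Continuous fun x => τ (p x) := (IsPlot.contDiff (hτ n p hp)).continuous
  refine isPlot_of_eventuallyEq fun x => ?_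
  rcases lt_trichotomy (τ (p x)) c with hx | hx | hx
  · refine ⟨_, hf n p hp, ?_⟩
    filter_upwards [hc.continuousAt.eventually (gt_mem_nhds hx)] with y hy
    simp [hy.le]
  · refine ⟨_, hf n p hp, ?_⟩
    have : ∀ᶠ y in 𝓝 x, |τ (p y) - c| < ε := by
      apply (hc.sub continuous_const).abs.continuousAt.eventually (gt_mem_nhds _)
      simpa [hx] using hε
    filter_upwards [this] with y hy
    simp only [Function.comp_apply]
    split_ifs
    · rfl
    · exact h _ hy
  · refine ⟨_, hg n p hp, ?_⟩
    filter_upwards [hc.continuousAt.eventually (lt_mem_nhds hx)] with y hy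
    simp [not_le.2 hy]

/-- A smooth step function, equal to `0` on `(-∞, 1/3]` and to `1` on `[2/3, ∞)`. -/
def smash (t : ℝ) : ℝ := Real.smoothTransition (3 * t - 1)

theorem smash_contDiff : ContDiff ℝ ∞ smash :=
  Real.smoothTransition.contDiff.comp ((contDiff_const.mul contDiff_id).sub contDiff_const)

theorem smash_of_le {t : ℝ} (h : t ≤ 1 / 3) : smash t = 0 :=
  Real.smoothTransition.zero_of_nonpos (by linarith)

theorem smash_of_ge {t : ℝ} (h : 2 / 3 ≤ t) : smash t = 1 :=
  Real.smoothTransition.one_of_one_le (by linarith)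

theorem smash_mem (t : ℝ) : 0 ≤ smash t ∧ smash t ≤ 1 :=
  ⟨Real.smoothTransition.nonneg _, Real.smoothTransition.le_one _⟩

/-- Concatenation of two paths, each of them made stationary near its ends first. -/
def concat {X : Type*} (a b : ℝ → X) (t : ℝ) : X :=
  if t ≤ 1 / 2 then a (smash (2 * t)) else b (smash (2 * t - 1))

theorem DSmooth.concat_family {X : Type*} [DiffeologicalSpace X] {W : Type*} [DiffeologicalSpace W] {a b : W → ℝ → X}
    (ha : DSmooth (fun q : W × ℝ => a q.1 q.2)) (hb : DSmooth (fun q : W × ℝ => b q.1 q.2))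
    (hab : ∀ s, a s 1 = b s 0) : DSmooth (fun q : W × ℝ => concat (a q.1) (b q.1) q.2) := by
  have h1 : ContDiff ℝ ∞ fun t : ℝ => smash (2 * t) :=
    smash_contDiff.comp (contDiff_const.mul contDiff_id)
  have h2 : ContDiff ℝ ∞ fun t : ℝ => smash (2 * t - 1) :=
    smash_contDiff.comp ((contDiff_const.mul contDiff_id).sub contDiff_const)
  refine DSmooth.glue (τ := fun q : W × ℝ => q.2) dSmooth_snd
    (f := fun q => a q.1 (smash (2 * q.2))) (g := fun q => b q.1 (smash (2 * q.2 - 1)))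
    (ha.comp (dSmooth_fst.prodMk (h1.dSmooth.comp dSmooth_snd)))
    (hb.comp (dSmooth_fst.prodMk (h2.dSmooth.comp dSmooth_snd))) (1 / 2) (ε := 1 / 6)
    (by norm_num) fun q hq => ?_
  rw [abs_lt] at hq
  rw [smash_of_ge (by linarith [hq.1]), smash_of_le (by linarith [hq.2]), hab]

theorem DSmooth.concat {X : Type*} [DiffeologicalSpace X] {a b : ℝ → X} (ha : DSmooth a) (hb : DSmooth b) (hab : a 1 = b 0) :
    DSmooth (concat a b) := by
  have := DSmooth.concat_family (W := ℝ) (a := fun _ => a) (b := fun _ => b)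
    (ha.comp dSmooth_snd) (hb.comp dSmooth_snd) fun _ => hab
  exact this.comp (dSmooth_const (y := (0 : ℝ)) |>.prodMk dSmooth_id)

@[simp] theorem concat_zero {X : Type*} (a b : ℝ → X) : concat a b 0 = a 0 := by
  simp [Diffeology.concat, smash_of_le]

@[simp] theorem concat_one {X : Type*} (a b : ℝ → X) : concat a b 1 = b 1 := by
  have : ¬ (1 : ℝ) ≤ 1 / 2 := by norm_num
  simp only [Diffeology.concat, this, if_false]
  rw [smash_of_ge (by norm_num)]

section Components

variable {X : Type*} [DiffeologicalSpace X]

variable (X) in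
/-- Two points are equivalent when a smooth path `γ : ℝ → X` has `γ 0 = x` and `γ 1 = y`. -/
def pathSetoid : Setoid X where
  r x y := ∃ γ : ℝ → X, DSmooth γ ∧ γ 0 = x ∧ γ 1 = y
  iseqv :=
    { refl := fun x => ⟨fun _ => x, dSmooth_const, rfl, rfl⟩
      symm := by
        rintro x y ⟨γ, hγ, h0, h1⟩
        refine ⟨fun t => γ (1 - t), hγ.comp (contDiff_const.sub contDiff_id).dSmooth, ?_, ?_⟩
        · simpa using h1
        · simpa using h0
      trans := by
        rintro x y z ⟨a, ha, ha0, ha1⟩ ⟨b, hb, hb0, hb1⟩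
        exact ⟨Diffeology.concat a b, ha.concat hb (by rw [ha1, hb0]), by simpa, by simpa⟩ }

variable (X) in
/-- The set of (smooth) path components of a diffeological space. -/
def Pi0 : Type _ := Quotient (pathSetoid X)

/-- The path component of a point. -/
def Pi0.mk (x : X) : Pi0 X := Quotient.mk (pathSetoid X) x

end Components

/-- The space of smooth loops `γ : ℝ → X`, `γ 0 = γ 1 = x`, as a subspace of the space of all
smooth maps from `ℝ` to `X`. -/
def LoopSpace (X : Type u) [DiffeologicalSpace X] (x : X) : Type u :=
  {γ : SmoothMap ℝ X // γ.toFun 0 = x ∧ γ.toFun 1 = x}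

instance instLoopSpace (X : Type u) [DiffeologicalSpace X] (x : X) :
    DiffeologicalSpace (LoopSpace X x) :=
  inferInstanceAs (DiffeologicalSpace {γ : SmoothMap ℝ X // γ.toFun 0 = x ∧ γ.toFun 1 = x})

namespace LoopSpace

variable {X : Type u} [DiffeologicalSpace X] {x : X}

instance : CoeFun (LoopSpace X x) (fun _ => ℝ → X) := ⟨fun γ => γ.1.toFun⟩

@[ext] theorem ext {γ δ : LoopSpace X x} (h : ∀ t, γ t = δ t) : γ = δ :=
  Subtype.ext (SmoothMap.ext (funext h))

/-- A smooth map `γ : ℝ → X` with `γ 0 = γ 1 = x`, as a point of the loop space. -/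
def mk (γ : ℝ → X) (hγ : DSmooth γ) (h0 : γ 0 = x) (h1 : γ 1 = x) : LoopSpace X x :=
  ⟨⟨γ, hγ⟩, h0, h1⟩

theorem smooth (γ : LoopSpace X x) : DSmooth γ := γ.1.smooth

@[simp] theorem apply_zero (γ : LoopSpace X x) : γ 0 = x := γ.2.1

@[simp] theorem apply_one (γ : LoopSpace X x) : γ 1 = x := γ.2.2

/-- The constant loop. -/
def const (X : Type u) [DiffeologicalSpace X] (x : X) : LoopSpace X x :=
  mk (fun _ => x) dSmooth_const rfl rfl

/-- A map into a loop space is smooth iff its evaluation map is smooth. -/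
theorem dSmooth_iff {W : Type*} [DiffeologicalSpace W] {f : W → LoopSpace X x} :
    DSmooth f ↔ DSmooth (fun q : W × ℝ => f q.1 q.2) := by
  constructor
  · intro h n p hp
    have h1 : DSmooth (fun q : EuclideanSpace ℝ (Fin n) × ℝ => f (p q.1).1 q.2) :=
      h n (fun y => (p y).1) hp.1
    exact h1 n (fun y => (y, (p y).2)) ⟨isPlot_id, hp.2⟩
  · intro h n p hp
    exact h.comp ((hp.dSmooth.comp dSmooth_fst).prodMk dSmooth_snd)

/-- The concatenation of two loops. -/
def comp (a b : LoopSpace X x) : LoopSpace X x :=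
  mk (concat a b) (a.smooth.concat b.smooth (by simp)) (by simp) (by simp)

/-- The reverse of a loop. -/
def rev (a : LoopSpace X x) : LoopSpace X x :=
  mk (fun t => a (1 - t)) (a.smooth.comp (contDiff_const.sub contDiff_id).dSmooth)
    (by simp) (by simp)

/-- Two loops that are reparametrizations of one smooth path, with the same ends, are joined. -/
theorem equiv_of_reparam {T : ℝ → X} (hT : DSmooth T) {φ ψ : ℝ → ℝ} (hφ : ContDiff ℝ ∞ φ)
    (hψ : ContDiff ℝ ∞ ψ) (h0 : φ 0 = ψ 0) (h1 : φ 1 = ψ 1) {a b : LoopSpace X x}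
    (ha : ∀ t, a t = T (φ t)) (hb : ∀ t, b t = T (ψ t)) :
    (pathSetoid (LoopSpace X x)).r a b := by
  have hh : ContDiff ℝ ∞ fun q : ℝ × ℝ => φ q.2 + q.1 * (ψ q.2 - φ q.2) :=
    (hφ.comp contDiff_snd).add
      (contDiff_fst.mul ((hψ.comp contDiff_snd).sub (hφ.comp contDiff_snd)))
  have hs : DSmooth fun q : ℝ × ℝ => T (φ q.2 + q.1 * (ψ q.2 - φ q.2)) := by
    refine hT.comp fun n p hp => ?_
    exact (hh.comp ((IsPlot.contDiff hp.1).prodMk (IsPlot.contDiff hp.2))).isPlot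
  refine ⟨fun s => mk (fun t => T (φ t + s * (ψ t - φ t)))
    (hs.comp (dSmooth_const.prodMk dSmooth_id)) ?_ ?_, dSmooth_iff.2 hs, ?_, ?_⟩
  · rw [← h0, sub_self, mul_zero, add_zero, ← ha, apply_zero]
  · rw [← h1, sub_self, mul_zero, add_zero, ← ha, apply_one]
  · ext t
    simp [mk, ha]
  · ext t
    simp [mk, hb]

theorem equiv_comp {a a₁ b b₁ : LoopSpace X x} (ha : (pathSetoid (LoopSpace X x)).r a a₁)
    (hb : (pathSetoid (LoopSpace X x)).r b b₁) :
    (pathSetoid (LoopSpace X x)).r (a.comp b) (a₁.comp b₁) := by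
  obtain ⟨α, hα, rfl, rfl⟩ := ha
  obtain ⟨β, hβ, rfl, rfl⟩ := hb
  exact ⟨fun s => (α s).comp (β s), dSmooth_iff.2 (DSmooth.concat_family
    (a := fun s => α s) (b := fun s => β s) (dSmooth_iff.1 hα) (dSmooth_iff.1 hβ)
    fun s => (apply_one (α s)).trans (apply_zero (β s)).symm), rfl, rfl⟩

theorem equiv_rev {a a₁ : LoopSpace X x} (ha : (pathSetoid (LoopSpace X x)).r a a₁) :
    (pathSetoid (LoopSpace X x)).r a.rev a₁.rev := by
  obtain ⟨α, hα, rfl, rfl⟩ := ha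
  exact ⟨fun s => (α s).rev, dSmooth_iff.2 ((dSmooth_iff.1 hα).comp (dSmooth_fst.prodMk
    ((contDiff_const.sub contDiff_id).dSmooth.comp dSmooth_snd))), rfl, rfl⟩

theorem smash_two_contDiff : ContDiff ℝ ∞ fun t : ℝ => smash (2 * t) :=
  smash_contDiff.comp (contDiff_const.mul contDiff_id)

theorem smash_two_sub_contDiff : ContDiff ℝ ∞ fun t : ℝ => smash (2 * t - 1) :=
  smash_contDiff.comp ((contDiff_const.mul contDiff_id).sub contDiff_const)

theorem smash_zero : smash 0 = 0 := smash_of_le (by norm_num)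

theorem smash_one : smash 1 = 1 := smash_of_ge (by norm_num)

/-- A loop made stationary near its ends. -/
def smashed (a : LoopSpace X x) : LoopSpace X x :=
  mk (fun t => a (smash t)) (a.smooth.comp smash_contDiff.dSmooth) (by simp [smash_zero])
    (by simp [smash_one])

theorem equiv_smashed (a : LoopSpace X x) : (pathSetoid (LoopSpace X x)).r a a.smashed :=
  equiv_of_reparam a.smooth contDiff_id smash_contDiff smash_zero.symm smash_one.symm
    (fun _ => rfl) (fun _ => rfl)

theorem one_comp (a : LoopSpace X x) :
    (pathSetoid (LoopSpace X x)).r ((const X x).comp a) a := by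
  refine equiv_of_reparam a.smooth smash_two_sub_contDiff contDiff_id ?_ ?_ (fun t => ?_)
    (fun _ => rfl)
  · simpa using smash_of_le (by norm_num)
  · norm_num [smash_one]
  · simp only [comp, const, mk, concat]
    split_ifs with h
    · rw [smash_of_le (by linarith), apply_zero]
    · rfl

theorem rev_comp (a : LoopSpace X x) :
    (pathSetoid (LoopSpace X x)).r (a.rev.comp a) (const X x) := by
  refine equiv_of_reparam (φ := fun t => 1 - smash (2 * t) + smash (2 * t - 1)) (ψ := fun _ => 1)
    a.smooth ((contDiff_const.sub smash_two_contDiff).add smash_two_sub_contDiff) contDiff_const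
    ?_ ?_ (fun t => ?_) (fun t => ?_)
  · rw [smash_of_le (by norm_num), smash_of_le (by norm_num)]; norm_num
  · rw [smash_of_ge (by norm_num), smash_of_ge (by norm_num)]; norm_num
  · simp only [comp, rev, mk, concat]
    split_ifs with h
    · rw [smash_of_le (t := 2 * t - 1) (by linarith), add_zero]
    · rw [smash_of_ge (t := 2 * t) (by linarith), sub_self, zero_add]
  · simp [const, mk]

/-- Three loops run through one after the other, on the interval from `0` to `3`. -/
def triple (a b c : LoopSpace X x) (t : ℝ) : X :=
  if t ≤ 1 then a (smash t) else if t ≤ 2 then b (smash (t - 1)) else c (smash (t - 2))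

theorem triple_smooth (a b c : LoopSpace X x) : DSmooth (triple a b c) := by
  have hs : ∀ k : ℝ, ContDiff ℝ ∞ fun t : ℝ => smash (t - k) := fun k =>
    smash_contDiff.comp (contDiff_id.sub contDiff_const)
  have h1 : DSmooth fun t : ℝ => if t ≤ 2 then b (smash (t - 1)) else c (smash (t - 2)) := by
    refine DSmooth.glue (τ := fun t : ℝ => t) dSmooth_id (b.smooth.comp (hs 1).dSmooth)
      (c.smooth.comp (hs 2).dSmooth) 2 (ε := 1 / 3) (by norm_num) fun t ht => ?_
    rw [abs_lt] at ht
    simp only [Function.comp_apply]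
    rw [smash_of_ge (by linarith [ht.1]), smash_of_le (by linarith [ht.2])]
    simp
  refine DSmooth.glue (τ := fun t : ℝ => t) dSmooth_id (a.smooth.comp smash_contDiff.dSmooth)
      h1 1 (ε := 1 / 3) (by norm_num) fun t ht => ?_
  rw [abs_lt] at ht
  rw [if_pos (by linarith [ht.2]), Function.comp_apply, smash_of_ge (by linarith [ht.1]),
    smash_of_le (by linarith [ht.2])]
  simp

theorem comp_assoc (a b c : LoopSpace X x) :
    (pathSetoid (LoopSpace X x)).r ((a.comp b).comp c) (a.comp (b.comp c)) := by
  have e := (pathSetoid (LoopSpace X x)).iseqv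
  refine e.trans (equiv_comp (e.refl _) (equiv_smashed c))
    (e.trans ?_ (equiv_comp (e.symm (equiv_smashed a)) (e.refl _)))
  refine equiv_of_reparam (triple_smooth a b c)
    (φ := fun t => 2 * smash (2 * t) + smash (2 * t - 1))
    (ψ := fun t => smash (2 * t) + 2 * smash (2 * t - 1))
    ((contDiff_const.mul smash_two_contDiff).add smash_two_sub_contDiff)
    (smash_two_contDiff.add (contDiff_const.mul smash_two_sub_contDiff)) ?_ ?_ (fun t => ?_)
    (fun t => ?_)
  · rw [smash_of_le (by norm_num), smash_of_le (by norm_num)]; norm_num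
  · rw [smash_of_ge (by norm_num), smash_of_ge (by norm_num)]; norm_num
  · simp only [comp, smashed, mk, concat, triple]
    by_cases h : t ≤ 1 / 2
    · have hm := smash_mem (2 * t)
      rw [if_pos h, smash_of_le (t := 2 * t - 1) (by linarith), add_zero]
      by_cases h' : smash (2 * t) ≤ 1 / 2
      · rw [if_pos h', if_pos (by linarith)]
      · rw [if_neg h', if_neg (by linarith), if_pos (by linarith)]
    · have hm := smash_mem (2 * t - 1)
      rw [if_neg h, smash_of_ge (t := 2 * t) (by linarith), if_neg (by linarith)]
      by_cases h' : smash (2 * t - 1) ≤ 0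
      · have h0 : smash (2 * t - 1) = 0 := le_antisymm h' hm.1
        rw [h0, if_pos (by norm_num), smash_zero, apply_zero,
          smash_of_ge (by norm_num), apply_one]
      · rw [if_neg (by linarith)]
        congr 2
        ring
  · simp only [comp, smashed, mk, concat, triple]
    by_cases h : t ≤ 1 / 2
    · have hm := smash_mem (2 * t)
      rw [if_pos h, smash_of_le (t := 2 * t - 1) (by linarith), if_pos (by linarith)]
      congr 2
      ring
    · have hm := smash_mem (2 * t - 1)
      have hge : smash (2 * t) = 1 := smash_of_ge (by linarith)
      rw [if_neg h, hge]
      by_cases h0 : smash (2 * t - 1) ≤ 0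
      · have h0' : smash (2 * t - 1) = 0 := le_antisymm h0 hm.1
        rw [h0', if_pos (by norm_num), if_pos (by norm_num), smash_of_le (by norm_num),
          apply_zero, smash_of_ge (by norm_num), apply_one]
      · have h3 : ¬ 1 + 2 * smash (2 * t - 1) ≤ 1 := by linarith
        have e1 : 1 + 2 * smash (2 * t - 1) - 1 = 2 * smash (2 * t - 1) := by ring
        have e2 : 1 + 2 * smash (2 * t - 1) - 2 = 2 * smash (2 * t - 1) - 1 := by ring
        rw [if_neg h3, e1, e2]
        by_cases h' : smash (2 * t - 1) ≤ 1 / 2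
        · rw [if_pos h', if_pos (by linarith)]
        · rw [if_neg h', if_neg (by linarith)]

end LoopSpace

/-- The fundamental group `π₁(X, x) = π₀(Loops(X, x))`; the product is induced by concatenation. -/
instance instGroupPi0LoopSpace (X : Type u) [DiffeologicalSpace X] (x : X) :
    Group (Pi0 (LoopSpace X x)) :=
  letI : Mul (Pi0 (LoopSpace X x)) :=
    ⟨Quotient.map₂ LoopSpace.comp fun _ _ h _ _ h' => LoopSpace.equiv_comp h h'⟩
  letI : One (Pi0 (LoopSpace X x)) := ⟨Pi0.mk (LoopSpace.const X x)⟩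
  letI : Inv (Pi0 (LoopSpace X x)) := ⟨Quotient.map LoopSpace.rev fun _ _ h => LoopSpace.equiv_rev h⟩
  Group.ofLeftAxioms
    (by
      rintro ⟨a⟩ ⟨b⟩ ⟨c⟩
      exact Quotient.sound (LoopSpace.comp_assoc a b c))
    (by
      rintro ⟨a⟩
      exact Quotient.sound (LoopSpace.one_comp a))
    (by
      rintro ⟨a⟩
      exact Quotient.sound (LoopSpace.rev_comp a))

/-- A diffeological space with a base point. -/
structure Pointed where
  /-- The underlying type. -/
  carrier : Type u
  [diffeology : DiffeologicalSpace carrier]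
  /-- The base point. -/
  pt : carrier

attribute [instance] Pointed.diffeology

/-- A smooth map that preserves base points. -/
structure PointedMap (X : Pointed.{u}) (Y : Pointed.{v}) where
  /-- The underlying map. -/
  toFun : X.carrier → Y.carrier
  smooth : DSmooth toFun
  map_pt : toFun X.pt = Y.pt

/-- The loop space, with the constant loop as base point. -/
def Pointed.loop (X : Pointed.{u}) : Pointed.{u} where
  carrier := LoopSpace X.carrier X.pt
  pt := LoopSpace.const X.carrier X.pt

/-- The iterated loop spaces. -/
def Pointed.iterLoop (X : Pointed.{u}) : ℕ → Pointed.{u}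
  | 0 => X
  | n + 1 => (X.iterLoop n).loop

/-- The map of loop spaces given by a pointed smooth map. -/
def PointedMap.loop {X : Pointed.{u}} {Y : Pointed.{v}} (f : PointedMap X Y) :
    PointedMap X.loop Y.loop where
  toFun := fun γ : LoopSpace X.carrier X.pt =>
    LoopSpace.mk (fun t => f.toFun (γ t)) (f.smooth.comp γ.smooth)
      (by rw [LoopSpace.apply_zero, f.map_pt]) (by rw [LoopSpace.apply_one, f.map_pt])
  smooth := LoopSpace.dSmooth_iff.2 (f.smooth.comp
    (LoopSpace.dSmooth_iff.1 (dSmooth_id (X := LoopSpace X.carrier X.pt))))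
  map_pt := LoopSpace.ext fun _ => f.map_pt

/-- The maps of iterated loop spaces given by a pointed smooth map. -/
def PointedMap.iterLoop {X : Pointed.{u}} {Y : Pointed.{v}} (f : PointedMap X Y) :
    ∀ n, PointedMap (X.iterLoop n) (Y.iterLoop n)
  | 0 => f
  | n + 1 => (f.iterLoop n).loop

/-- The diffeological homotopy groups: `π_n` is the set of path components of the `n`-th iterated
loop space. -/
def DHomotopyGroup (n : ℕ) (X : Pointed.{u}) : Type u := Pi0 (X.iterLoop n).carrier

namespace DHomotopyGroup

/-- For `n ≥ 1`, `π_n(X)` is the fundamental group of the `(n - 1)`-st iterated loop space. -/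
instance instGroup (n : ℕ) (X : Pointed.{u}) : Group (DHomotopyGroup (n + 1) X) :=
  inferInstanceAs (Group (Pi0 (LoopSpace (X.iterLoop n).carrier (X.iterLoop n).pt)))

/-- The base point of `π_n(X)`, the class of the constant map. -/
def base (n : ℕ) (X : Pointed.{u}) : DHomotopyGroup n X := Pi0.mk (X.iterLoop n).pt

/-- For `n ≥ 1` the base point is the unit of the group. -/
theorem base_succ (n : ℕ) (X : Pointed.{u}) : base (n + 1) X = 1 := rfl

/-- The map induced on `π_n` by a pointed smooth map. -/
def map (n : ℕ) {X : Pointed.{u}} {Y : Pointed.{v}} (f : PointedMap X Y) :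
    DHomotopyGroup n X → DHomotopyGroup n Y :=
  Quotient.map (f.iterLoop n).toFun fun _ _ ⟨γ, hγ, h0, h1⟩ =>
    ⟨fun t => (f.iterLoop n).toFun (γ t), (f.iterLoop n).smooth.comp hγ,
      congrArg _ h0, congrArg _ h1⟩

/-- For `n ≥ 1` the induced map is a homomorphism. -/
theorem map_mul (n : ℕ) {X : Pointed.{u}} {Y : Pointed.{v}} (f : PointedMap X Y)
    (a b : DHomotopyGroup (n + 1) X) :
    map (n + 1) f (a * b) = map (n + 1) f a * map (n + 1) f b := by
  obtain ⟨a, rfl⟩ := Quotient.exists_rep a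
  obtain ⟨b, rfl⟩ := Quotient.exists_rep b
  refine congrArg (Quotient.mk _) (LoopSpace.ext fun t => ?_)
  change (f.iterLoop n).toFun (concat _ _ t) = concat _ _ t
  simp only [concat]
  split_ifs <;> rfl

end DHomotopyGroup

/-! ### Diffeological groups and extensions -/

/-- A diffeological group: multiplication and inversion are smooth. -/
class DiffeologicalGroup (G : Type u) [Group G] [DiffeologicalSpace G] : Prop where
  smooth_mul : DSmooth (fun q : G × G => q.1 * q.2)
  smooth_inv : DSmooth (fun g : G => g⁻¹)

/-- An induction: an injective map whose source carries the diffeology pulled back from the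
target. -/
def IsInduction {X : Type u} {Y : Type v} [DiffeologicalSpace X] [DiffeologicalSpace Y]
    (f : X → Y) : Prop :=
  Function.Injective f ∧
    ∀ (n : ℕ) (p : EuclideanSpace ℝ (Fin n) → X), IsPlot p ↔ IsPlot (f ∘ p)

/-- A subduction: a smooth surjective map through which the plots of the target lift locally. -/
def IsSubduction {X : Type u} {Y : Type v} [DiffeologicalSpace X] [DiffeologicalSpace Y]
    (f : X → Y) : Prop :=
  Function.Surjective f ∧ DSmooth f ∧
    ∀ (n : ℕ) (p : EuclideanSpace ℝ (Fin n) → Y), IsPlot p → ∀ x,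
      ∃ q : EuclideanSpace ℝ (Fin n) → X, IsPlot q ∧ ∀ᶠ y in 𝓝 x, f (q y) = p y

/-- A diffeological extension `1 → G → G' → G'' → 1`: a short exact sequence of groups, in which
the first map is an induction and the second one a subduction. -/
structure IsExtension {G : Type u} {G' : Type v} {G'' : Type w} [Group G] [Group G'] [Group G'']
    [DiffeologicalSpace G] [DiffeologicalSpace G'] [DiffeologicalSpace G'']
    (i : G →* G') (p : G' →* G'') : Prop where
  isInduction : IsInduction i
  isSubduction : IsSubduction p
  exact : i.range = p.ker

theorem IsExtension.smooth_left {G : Type u} {G' : Type v} {G'' : Type w} [Group G] [Group G']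
    [Group G''] [DiffeologicalSpace G] [DiffeologicalSpace G'] [DiffeologicalSpace G'']
    {i : G →* G'} {p : G' →* G''} (h : IsExtension i p) : DSmooth i :=
  fun n q hq => (h.isInduction.2 n q).1 hq

theorem IsExtension.smooth_right {G : Type u} {G' : Type v} {G'' : Type w} [Group G] [Group G']
    [Group G''] [DiffeologicalSpace G] [DiffeologicalSpace G'] [DiffeologicalSpace G'']
    {i : G →* G'} {p : G' →* G''} (h : IsExtension i p) : DSmooth p :=
  h.isSubduction.2.1

/-! ### The join and Milnor's classifying space -/

/-- The sequences `(tᵢ, xᵢ)` with `tᵢ ∈ [0, 1]`, finitely many `tᵢ` non-zero and `∑ tᵢ = 1`, as a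
subspace of the product. -/
def PreJoin (X : ℕ → Type u) : Type u :=
  {q : (ℕ → Set.Icc (0 : ℝ) 1) × (∀ i, X i) //
    {i | (q.1 i : ℝ) ≠ 0}.Finite ∧ ∑ᶠ i, (q.1 i : ℝ) = 1}

instance instPreJoin (X : ℕ → Type u) [∀ i, DiffeologicalSpace (X i)] :
    DiffeologicalSpace (PreJoin X) :=
  inferInstanceAs (DiffeologicalSpace {q : (ℕ → {t : ℝ // t ∈ Set.Icc (0 : ℝ) 1}) × (∀ i, X i) //
    {i | (q.1 i : ℝ) ≠ 0}.Finite ∧ ∑ᶠ i, (q.1 i : ℝ) = 1})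

/-- Two sequences are identified when they have the same `tᵢ`, and the same `xᵢ` wherever
`tᵢ ≠ 0`. -/
def joinSetoid (X : ℕ → Type u) : Setoid (PreJoin X) where
  r a b := ∀ i, a.1.1 i = b.1.1 i ∧ ((a.1.1 i : ℝ) ≠ 0 → a.1.2 i = b.1.2 i)
  iseqv :=
    { refl := fun _ _ => ⟨rfl, fun _ => rfl⟩
      symm := fun h i => ⟨(h i).1.symm, fun h0 => ((h i).2 (by rwa [(h i).1])).symm⟩
      trans := fun h h' i => ⟨(h i).1.trans (h' i).1,
        fun h0 => ((h i).2 h0).trans ((h' i).2 (by rwa [← (h i).1]))⟩ }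

/-- The join of a sequence of diffeological spaces, with the quotient diffeology. -/
def Join (X : ℕ → Type u) : Type u := Quotient (joinSetoid X)

instance instJoin (X : ℕ → Type u) [∀ i, DiffeologicalSpace (X i)] :
    DiffeologicalSpace (Join X) :=
  inferInstanceAs (DiffeologicalSpace (Quotient (joinSetoid X)))

/-- The map `(tᵢ, xᵢ) ↦ (tᵢ, f xᵢ)`. -/
def PreJoin.map {X : Type u} {Y : Type v} (f : X → Y) (a : PreJoin fun _ => X) :
    PreJoin fun _ => Y :=
  ⟨(a.1.1, fun i => f (a.1.2 i)), a.2⟩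

/-- The map `(tᵢ xᵢ) ↦ (tᵢ f(xᵢ))` of joins. -/
def Join.map {X : Type u} {Y : Type v} (f : X → Y) : (Join fun _ => X) → Join fun _ => Y :=
  Quotient.map (PreJoin.map f) fun _ _ h i => ⟨(h i).1, fun h0 => congrArg f ((h i).2 h0)⟩

/-- The total space `EG`, the join of countably many copies of `G`. -/
def EG (G : Type u) : Type u := Join fun _ : ℕ => G

instance instEG (G : Type u) [DiffeologicalSpace G] : DiffeologicalSpace (EG G) :=
  inferInstanceAs (DiffeologicalSpace (Join fun _ : ℕ => G))

/-- The action `h • (tᵢ gᵢ) = (tᵢ gᵢ h⁻¹)` of `G` on `EG`. -/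
instance instMulActionEG (G : Type u) [Group G] : MulAction G (EG G) where
  smul h := Join.map fun g : G => g * h⁻¹
  one_smul := by
    rintro ⟨a⟩
    refine congrArg (Quotient.mk _) (Subtype.ext (Prod.ext rfl (funext fun i => ?_)))
    simp [PreJoin.map]
  mul_smul := by
    rintro g h ⟨a⟩
    refine congrArg (Quotient.mk _) (Subtype.ext (Prod.ext rfl (funext fun i => ?_)))
    simp [PreJoin.map, mul_assoc]

/-- The map `(tᵢ gᵢ) ↦ (tᵢ φ(gᵢ))` from `EG` to `EH`. -/
def EG.map {G : Type u} {H : Type v} (φ : G → H) : EG G → EG H := Join.map φ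

/-- The classifying space `BG = EG / G`, with the quotient diffeology. -/
def BG (G : Type u) [Group G] : Type u := Quotient (MulAction.orbitRel G (EG G))

instance instBG (G : Type u) [Group G] [DiffeologicalSpace G] : DiffeologicalSpace (BG G) :=
  inferInstanceAs (DiffeologicalSpace (Quotient (MulAction.orbitRel G (EG G))))

/-- The map of quotients given by a smooth map is smooth. -/
theorem DSmooth.quotientMap {X : Type*} {Y : Type*} [DiffeologicalSpace X] [DiffeologicalSpace Y]
    {r : Setoid X} {s : Setoid Y} {f : X → Y} (hf : DSmooth f)
    (h : ∀ a b, r a b → s (f a) (f b)) :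
    DSmooth (Quotient.map f h : Quotient r → Quotient s) := by
  intro n p hp x
  obtain ⟨q, hq, hqp⟩ := hp x
  refine ⟨f ∘ q, hf n q hq, ?_⟩
  filter_upwards [hqp] with y hy
  rw [Function.comp_apply (f := Quotient.map f h), ← hy]
  rfl

theorem EG.map_smooth {G : Type u} {H : Type v} [DiffeologicalSpace G] [DiffeologicalSpace H]
    {φ : G → H} (hφ : DSmooth φ) : DSmooth (EG.map φ) := by
  refine DSmooth.quotientMap (f := PreJoin.map φ) (fun n p hp => ?_)
    fun _ _ h i => ⟨(h i).1, fun h0 => congrArg φ ((h i).2 h0)⟩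
  exact ⟨hp.1, fun i => hφ n _ (hp.2 i)⟩

theorem EG.map_smul {G : Type u} {H : Type v} [Group G] [Group H] (φ : G →* H) (g : G)
    (a : EG G) : EG.map φ (g • a) = φ g • EG.map φ a := by
  obtain ⟨a, rfl⟩ := Quotient.exists_rep a
  refine congrArg (Quotient.mk _) (Subtype.ext (Prod.ext rfl (funext fun i => ?_)))
  simp [PreJoin.map]

/-- The map `[tᵢ gᵢ] ↦ [tᵢ φ(gᵢ)]` of classifying spaces given by a homomorphism. -/
def BG.map {G : Type u} {H : Type v} [Group G] [Group H] (φ : G →* H) : BG G → BG H :=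
  Quotient.map (EG.map φ) fun _ b ⟨g, hg⟩ => ⟨φ g, by
    change g • b = _ at hg
    change φ g • EG.map φ b = _
    rw [← EG.map_smul, hg]⟩

theorem BG.map_smooth {G : Type u} {H : Type v} [Group G] [Group H] [DiffeologicalSpace G]
    [DiffeologicalSpace H] {φ : G →* H} (hφ : DSmooth φ) : DSmooth (BG.map φ) :=
  DSmooth.quotientMap (EG.map_smooth hφ) _

/-- The classifying space with a base point. -/
def BG.pointed (G : Type u) [Group G] [DiffeologicalSpace G] (x : BG G) : Pointed.{u} where
  carrier := BG G
  pt := x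

/-- The map of classifying spaces, as a pointed smooth map. -/
def BG.pointedMap {G : Type u} {H : Type v} [Group G] [Group H] [DiffeologicalSpace G]
    [DiffeologicalSpace H] (φ : G →* H) (hφ : DSmooth φ) (x : BG G) :
    PointedMap (BG.pointed G x) (BG.pointed H (BG.map φ x)) where
  toFun := BG.map φ
  smooth := BG.map_smooth hφ
  map_pt := rfl

end Diffeology

end

open Diffeology

noncomputable section

namespace Diffeology

universe u v w u' v' w'

/-! ### Smooth retracts of Euclidean spaces -/

/-! Everything comes from principal fibrations K → E → B: a group K acts freely on E with orbits the
fibres over B, division in the fibres is smooth, and plots of B lift to E. The extension is one,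
with G acting on G' by left multiplication over G''; so is H → EH → BH for each diffeological group
H.

A principal fibration has a long exact sequence. Exactness is proved in the lowest degree only, by
lifting paths and dividing in the fibres. Higher degrees follow because loop spaces turn a principal
fibration into a principal fibration (`PrincipalFibration.loop`). Plots of the base are at first
known to lift only locally; since two lifts differ by a plot of K, local lifts can be glued over a
Euclidean space (`PrincipalAction.toFibration`).

As EH is smoothly contractible, the boundary maps are bijections π_{n+1}(BH) → π_n(H), natural in H
(`PrincipalFibration.Hom.boundary_map`). They carry the sequence of the extension, moved up by one
degree, to the sequence of classifying spaces: δ_{n+1} is the boundary map π_{n+1}(G'') → π_n(G)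
seen through these bijections. It is a homomorphism because pointwise multiplication and
concatenation of loops in a group agree on path components (`DHomotopyGroup.mul_eq_pi0Mul`). At the
bottom, π_0(BG) is a point, so δ_0 is constant, and exactness at π_1(BG'') means that π_0(G') →
π_0(G'') is onto, which holds because p is surjective.

To contract EH, weights are moved linearly while group elements stay fixed
(`EG.smoothlyHomotopic_of_common_rep`): the weight is pushed to early coordinates, then moved to
later ones that hold the unit, then to a vertex. The contraction does not fix the base point, but it
induces contractions of all iterated loop spaces (`Pointed.SmoothlyContractible.loop`), which is
enough to kill the homotopy groups. -/

/-- A diffeological space that is a smooth retract of some Euclidean space. -/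
class IsEuclideanRetract (W : Type*) [DiffeologicalSpace W] : Prop where
  exists_retract : ∃ (n : ℕ) (φ : EuclideanSpace ℝ (Fin n) → W) (ψ : W → EuclideanSpace ℝ (Fin n)),
    DSmooth φ ∧ DSmooth ψ ∧ ∀ x, φ (ψ x) = x

instance (n : ℕ) : IsEuclideanRetract (EuclideanSpace ℝ (Fin n)) :=
  ⟨n, id, id, dSmooth_id, dSmooth_id, fun _ => rfl⟩

instance : IsEuclideanRetract ℝ := by
  refine ⟨1, fun x => x 0, fun t => WithLp.toLp 2 fun _ => t, ?_, ?_, fun _ => rfl⟩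
  · exact ContDiff.dSmooth (by fun_prop)
  · exact ContDiff.dSmooth (contDiff_euclidean.2 fun _ => contDiff_id)

instance {W : Type*} [DiffeologicalSpace W] [IsEuclideanRetract W] :
    IsEuclideanRetract (W × ℝ) := by
  obtain ⟨n, φ, ψ, hφ, hψ, h⟩ := IsEuclideanRetract.exists_retract (W := W)
  refine ⟨n + 1, fun x => (φ (WithLp.toLp 2 fun i : Fin n => x i.castSucc), x (Fin.last n)),
    fun q => WithLp.toLp 2 (Fin.snoc (α := fun _ => ℝ) (fun i => ψ q.1 i) q.2), ?_, ?_, ?_⟩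
  · refine (hφ.comp' ?_).prodMk ?_
    · exact ContDiff.dSmooth (contDiff_euclidean.2 fun _ => by fun_prop)
    · exact ContDiff.dSmooth (by fun_prop)
  · intro m p hp
    refine ContDiff.isPlot (contDiff_euclidean.2 fun i => ?_)
    refine Fin.lastCases ?_ (fun i => ?_) i
    · simpa [Function.comp_def] using hp.2.contDiff
    · simpa [Function.comp_def] using
        (contDiff_euclidean.1 (IsPlot.contDiff (hψ m _ hp.1)) i)
  · rintro ⟨w, t⟩
    simp [h]

/-! ### Groups in pointed diffeological spaces -/

/-- A smooth group structure on a pointed diffeological space whose unit is the base point. -/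
class PointedGroup (K : Pointed.{u}) extends Group K.carrier where
  smooth_mul : DSmooth fun q : K.carrier × K.carrier => q.1 * q.2
  smooth_inv : DSmooth fun k : K.carrier => k⁻¹
  pt_eq_one : K.pt = 1

theorem DSmooth.mul {K : Pointed.{u}} [PointedGroup K] {W : Type*} [DiffeologicalSpace W]
    {f g : W → K.carrier} (hf : DSmooth f) (hg : DSmooth g) : DSmooth fun x => f x * g x :=
  (PointedGroup.smooth_mul (K := K)).comp (hf.prodMk hg)

theorem DSmooth.inv {K : Pointed.{u}} [PointedGroup K] {W : Type*} [DiffeologicalSpace W]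
    {f : W → K.carrier} (hf : DSmooth f) : DSmooth fun x => (f x)⁻¹ :=
  (PointedGroup.smooth_inv (K := K)).comp hf

namespace LoopSpace

theorem smooth_eval {X : Type*} [DiffeologicalSpace X] {x : X} {W : Type*} [DiffeologicalSpace W]
    {f : W → LoopSpace X x} (hf : DSmooth f) {τ : W → ℝ} (hτ : DSmooth τ) :
    DSmooth fun w => f w (τ w) :=
  (dSmooth_iff.1 hf).comp (dSmooth_id.prodMk hτ)

@[simp] theorem mk_apply {X : Type*} [DiffeologicalSpace X] {x : X} (γ : ℝ → X) (hγ : DSmooth γ)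
    (h0 : γ 0 = x) (h1 : γ 1 = x) (t : ℝ) : (mk γ hγ h0 h1) t = γ t := rfl

end LoopSpace

section PointedGroup

variable (K : Pointed.{u}) [PointedGroup K]

instance : Mul (LoopSpace K.carrier K.pt) where
  mul a b := LoopSpace.mk (fun t => a t * b t) (a.smooth.mul b.smooth)
    (by simp [PointedGroup.pt_eq_one]) (by simp [PointedGroup.pt_eq_one])

instance : Inv (LoopSpace K.carrier K.pt) where
  inv a := LoopSpace.mk (fun t => (a t)⁻¹) a.smooth.inv
    (by simp [PointedGroup.pt_eq_one]) (by simp [PointedGroup.pt_eq_one])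

instance : One (LoopSpace K.carrier K.pt) := ⟨LoopSpace.const _ _⟩

variable {K} in
@[simp] theorem LoopSpace.mul_apply (a b : LoopSpace K.carrier K.pt) (t : ℝ) :
    (a * b) t = a t * b t := rfl

variable {K} in
@[simp] theorem LoopSpace.inv_apply (a : LoopSpace K.carrier K.pt) (t : ℝ) :
    a⁻¹ t = (a t)⁻¹ := rfl

variable {K} in
@[simp] theorem LoopSpace.one_apply (t : ℝ) : (1 : LoopSpace K.carrier K.pt) t = 1 :=
  PointedGroup.pt_eq_one

instance : Group (LoopSpace K.carrier K.pt) :=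
  Group.ofLeftAxioms (fun a b c => LoopSpace.ext fun t => by simp [mul_assoc])
    (fun a => LoopSpace.ext fun t => by simp) (fun a => LoopSpace.ext fun t => by simp)

/-- Pointwise multiplication of loops in a group. -/
instance instPointedGroupLoop : PointedGroup K.loop where
  toGroup := inferInstanceAs (Group (LoopSpace K.carrier K.pt))
  smooth_mul := LoopSpace.dSmooth_iff.2 <| by
    exact DSmooth.mul
      (LoopSpace.smooth_eval (x := K.pt) (dSmooth_fst.comp dSmooth_fst) dSmooth_snd)
      (LoopSpace.smooth_eval (x := K.pt) (dSmooth_snd.comp dSmooth_fst) dSmooth_snd)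
  smooth_inv := LoopSpace.dSmooth_iff.2 <| by
    exact DSmooth.inv (LoopSpace.smooth_eval (x := K.pt) dSmooth_fst dSmooth_snd)
  pt_eq_one := rfl

instance instPointedGroupIterLoop : ∀ n, PointedGroup (K.iterLoop n)
  | 0 => inferInstanceAs (PointedGroup K)
  | n + 1 => @instPointedGroupLoop (K.iterLoop n) (instPointedGroupIterLoop n)

end PointedGroup

/-! ### Principal fibrations -/

/-- A group acting freely on the fibres of a map, such that two plots of the total space with the
same projection differ by a plot of the group. -/
structure PrincipalAction (K : Pointed.{u}) (E : Pointed.{v}) (B : Pointed.{w})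
    [PointedGroup K] where
  /-- The action. -/
  act : K.carrier → E.carrier → E.carrier
  /-- The projection. -/
  proj : PointedMap E B
  one_act : ∀ a, act 1 a = a
  mul_act : ∀ k l a, act (k * l) a = act k (act l a)
  smooth_act : DSmooth fun q : K.carrier × E.carrier => act q.1 q.2
  proj_act : ∀ k a, proj.toFun (act k a) = proj.toFun a
  free : ∀ k a, act k a = a → k = 1
  exists_div_plot : ∀ (n : ℕ) (a b : EuclideanSpace ℝ (Fin n) → E.carrier), IsPlot a → IsPlot b →
    (∀ x, proj.toFun (a x) = proj.toFun (b x)) →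
      ∃ k : EuclideanSpace ℝ (Fin n) → K.carrier, IsPlot k ∧ ∀ x, act (k x) (a x) = b x

/-- A principal action such that the plots of the base lift to the total space with a prescribed
value at the origin. -/
structure PrincipalFibration (K : Pointed.{u}) (E : Pointed.{v}) (B : Pointed.{w})
    [PointedGroup K] extends PrincipalAction K E B where
  exists_lift_plot : ∀ (n : ℕ) (f : EuclideanSpace ℝ (Fin n) → B.carrier), IsPlot f → ∀ e,
    proj.toFun e = f 0 → ∃ g : EuclideanSpace ℝ (Fin n) → E.carrier,
      IsPlot g ∧ (∀ x, proj.toFun (g x) = f x) ∧ g 0 = e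

namespace PrincipalAction

variable {K : Pointed.{u}} {E : Pointed.{v}} {B : Pointed.{w}} [PointedGroup K]
  (P : PrincipalAction K E B) {W : Type*} [DiffeologicalSpace W]

theorem act_inv_act (k : K.carrier) (a : E.carrier) : P.act k⁻¹ (P.act k a) = a := by
  rw [← P.mul_act, inv_mul_cancel, P.one_act]

theorem act_left_injective {k l : K.carrier} {a : E.carrier} (h : P.act k a = P.act l a) :
    k = l := by
  have : P.act (l⁻¹ * k) a = a := by rw [P.mul_act, h, act_inv_act]
  exact (inv_mul_eq_one.1 (P.free _ _ this)).symm

theorem act_dSmooth {k : W → K.carrier} {a : W → E.carrier} (hk : DSmooth k) (ha : DSmooth a) :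
    DSmooth fun x => P.act (k x) (a x) :=
  P.smooth_act.comp (hk.prodMk ha)

/-- The fibres are orbits. -/
theorem exists_act_eq {a b : E.carrier} (h : P.proj.toFun a = P.proj.toFun b) :
    ∃ k, P.act k a = b := by
  obtain ⟨k, -, hk⟩ := P.exists_div_plot 0 (fun _ => a) (fun _ => b) isPlot_const isPlot_const
    fun _ => h
  exact ⟨k 0, hk 0⟩

/-- Division in the fibres is smooth. -/
theorem exists_div {a b : W → E.carrier} (ha : DSmooth a) (hb : DSmooth b)
    (h : ∀ x, P.proj.toFun (a x) = P.proj.toFun (b x)) :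
    ∃ k : W → K.carrier, DSmooth k ∧ ∀ x, P.act (k x) (a x) = b x := by
  choose k hk using fun x => P.exists_act_eq (h x)
  refine ⟨k, fun n p hp => ?_, hk⟩
  obtain ⟨l, hl, hl'⟩ := P.exists_div_plot n (a ∘ p) (b ∘ p) (ha n p hp) (hb n p hp) fun x => h _
  -- Freeness makes the quotient unique, so the pointwise choice k must agree with the plot l.
  have : k ∘ p = l := funext fun x => P.act_left_injective ((hk (p x)).trans (hl' x).symm)
  rwa [this]

end PrincipalAction

namespace PrincipalFibration

variable {K : Pointed.{u}} {E : Pointed.{v}} {B : Pointed.{w}} [PointedGroup K]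
  (P : PrincipalFibration K E B) {W : Type*} [DiffeologicalSpace W]

/-- Maps from smooth retracts of Euclidean spaces lift, with a prescribed value at one point. -/
theorem exists_lift [IsEuclideanRetract W] {f : W → B.carrier} (hf : DSmooth f) (w₀ : W)
    {e : E.carrier} (he : P.proj.toFun e = f w₀) :
    ∃ g : W → E.carrier, DSmooth g ∧ (∀ x, P.proj.toFun (g x) = f x) ∧ g w₀ = e := by
  obtain ⟨n, φ, ψ, hφ, hψ, h⟩ := IsEuclideanRetract.exists_retract (W := W)
  have h1 : DSmooth fun x : EuclideanSpace ℝ (Fin n) => x + ψ w₀ :=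
    (contDiff_id.add contDiff_const).dSmooth
  have h2 : DSmooth fun x : EuclideanSpace ℝ (Fin n) => x - ψ w₀ :=
    (contDiff_id.sub contDiff_const).dSmooth
  -- Composing with φ extends f to a Euclidean space. The translation moves ψ w₀ to the origin, the
  -- only place where a value can be prescribed.
  obtain ⟨g, hg, hgf, hg0⟩ := P.exists_lift_plot n (fun x => f (φ (x + ψ w₀)))
    (hf.comp (hφ.comp h1)).isPlot e (by simp [h, he])
  exact ⟨fun x => g (ψ x - ψ w₀), hg.dSmooth.comp (h2.comp hψ), fun x => by simp [hgf, h],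
    by simp [hg0]⟩

/-- A lift of a family of loops whose value at one parameter is a prescribed family of loops. -/
theorem exists_lift_loop [IsEuclideanRetract W] {f : W → LoopSpace B.carrier B.pt}
    (hf : DSmooth f) (w₀ : W) {e : LoopSpace E.carrier E.pt}
    (he : ∀ t, P.proj.toFun (e t) = f w₀ t) :
    ∃ g : W → LoopSpace E.carrier E.pt,
      DSmooth g ∧ (∀ x t, P.proj.toFun (g x t) = f x t) ∧ g w₀ = e := by
  obtain ⟨g, hg, hgf, -⟩ := P.exists_lift (LoopSpace.dSmooth_iff.1 hf) (w₀, 0) (he 0)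
  have hs : ∀ c : ℝ, DSmooth fun x : W => ((x, c) : W × ℝ) := fun c =>
    dSmooth_id.prodMk dSmooth_const
  have hw : DSmooth fun t : ℝ => ((w₀, t) : W × ℝ) := dSmooth_const.prodMk dSmooth_id
  -- c corrects the lift so that it equals e over w₀. The functions a and b below then measure how
  -- far the corrected lift is from the base point at t = 0 and at t = 1.
  obtain ⟨c, hc, hc'⟩ := P.exists_div (hg.comp hw) e.smooth fun t => by
    simp [hgf, he]
  have hg₁ : DSmooth fun q : W × ℝ => P.act (c q.2) (g q) := P.act_dSmooth (hc.comp dSmooth_snd) hg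
  have hpt : ∀ x (s : ℝ), f x s = B.pt →
      P.proj.toFun (P.act (c s) (g (x, s))) = P.proj.toFun E.pt := by
    intro x s h
    rw [P.proj_act, hgf, h, P.proj.map_pt]
  obtain ⟨a, ha, ha'⟩ := P.exists_div (hg₁.comp (hs 0)) dSmooth_const fun x =>
    hpt x 0 (LoopSpace.apply_zero _)
  obtain ⟨b, hb, hb'⟩ := P.exists_div (hg₁.comp (hs 1)) dSmooth_const fun x =>
    hpt x 1 (LoopSpace.apply_one _)
  have hcw : ∀ t, P.act (c t) (g (w₀, t)) = e t := hc'
  have ha0 : a w₀ = 1 := P.free _ E.pt <| by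
    have := ha' w₀
    simpa [hcw] using this
  have hb0 : b w₀ = 1 := P.free _ E.pt <| by
    have := hb' w₀
    simpa [hcw] using this
  -- W contracts to w₀ by r(s, x) = φ(ψ w₀ + s(ψ x − ψ w₀)). Since a and b are 1 at w₀, the factor
  -- a(r(1 − t, x)) b(r(t, x)) is a(x) at t = 0, b(x) at t = 1, and 1 for x = w₀: it closes the
  -- loops and keeps e.
  obtain ⟨n, φ, ψ, hφ, hψ, h⟩ := IsEuclideanRetract.exists_retract (W := W)
  have hr : DSmooth fun q : ℝ × W => φ (ψ w₀ + q.1 • (ψ q.2 - ψ w₀)) := by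
    refine hφ.comp fun m p hp => ContDiff.isPlot ?_
    have h1 := IsPlot.contDiff hp.1
    have h2 := IsPlot.contDiff (hψ m _ hp.2)
    exact contDiff_const.add (h1.smul (h2.sub contDiff_const))
  have hr1 : DSmooth fun q : W × ℝ => φ (ψ w₀ + (1 - q.2) • (ψ q.1 - ψ w₀)) :=
    hr.comp (((contDiff_const.sub contDiff_id).dSmooth.comp dSmooth_snd).prodMk dSmooth_fst)
  have hr2 : DSmooth fun q : W × ℝ => φ (ψ w₀ + q.2 • (ψ q.1 - ψ w₀)) :=
    hr.comp (dSmooth_snd.prodMk dSmooth_fst)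
  have hG : DSmooth fun q : W × ℝ => P.act (a (φ (ψ w₀ + (1 - q.2) • (ψ q.1 - ψ w₀))) *
      b (φ (ψ w₀ + q.2 • (ψ q.1 - ψ w₀)))) (P.act (c q.2) (g q)) :=
    P.act_dSmooth ((ha.comp hr1).mul (hb.comp hr2)) hg₁
  refine ⟨fun x => LoopSpace.mk (fun t => P.act (a (φ (ψ w₀ + (1 - t) • (ψ x - ψ w₀))) *
      b (φ (ψ w₀ + t • (ψ x - ψ w₀)))) (P.act (c t) (g (x, t))))
      (hG.comp (dSmooth_const.prodMk dSmooth_id)) ?_ ?_, LoopSpace.dSmooth_iff.2 hG, ?_, ?_⟩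
  · have := ha' x
    simpa [h, hb0] using this
  · have := hb' x
    simpa [h, ha0] using this
  · intro x t
    simp [P.proj_act, hgf]
  · ext t
    simp [h, ha0, hb0, P.one_act, hcw]

/-- The loop spaces of a principal fibration. -/
def loop : PrincipalFibration K.loop E.loop B.loop where
  act := fun (k : LoopSpace K.carrier K.pt) (a : LoopSpace E.carrier E.pt) =>
    LoopSpace.mk (fun t => P.act (k t) (a t)) (P.act_dSmooth k.smooth a.smooth)
      (by simp [PointedGroup.pt_eq_one, P.one_act]) (by simp [PointedGroup.pt_eq_one, P.one_act])
  proj := P.proj.loop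
  one_act a := LoopSpace.ext fun t => by
    refine Eq.trans ?_ (P.one_act _)
    exact congrArg (P.act · _) (LoopSpace.one_apply (K := K) t)
  mul_act k l a := LoopSpace.ext fun t => P.mul_act _ _ _
  smooth_act := LoopSpace.dSmooth_iff.2 <| P.act_dSmooth
    (LoopSpace.smooth_eval (x := K.pt) (dSmooth_fst.comp dSmooth_fst) dSmooth_snd)
    (LoopSpace.smooth_eval (x := E.pt) (dSmooth_snd.comp dSmooth_fst) dSmooth_snd)
  proj_act k a := LoopSpace.ext fun t => P.proj_act _ _
  free k a h := LoopSpace.ext fun t =>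
    (P.free _ _ (congrArg (fun γ : LoopSpace E.carrier E.pt => γ t) h)).trans
      (LoopSpace.one_apply (K := K) t).symm
  exists_div_plot n a b ha hb h := by
    have h' : ∀ x t, P.proj.toFun ((show LoopSpace E.carrier E.pt from a x) t) =
        P.proj.toFun ((show LoopSpace E.carrier E.pt from b x) t) := fun x t =>
      congrArg (fun γ : LoopSpace B.carrier B.pt => γ t) (h x)
    obtain ⟨k, hk, hk'⟩ := P.exists_div (LoopSpace.dSmooth_iff.1 ha.dSmooth)
      (LoopSpace.dSmooth_iff.1 hb.dSmooth) fun q => h' q.1 q.2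
    -- Both loops are at the base point when t is 0 or 1, so freeness makes the quotient trivial
    -- there and k is a family of loops.
    have h0 : ∀ x, k (x, 0) = K.pt := fun x => (P.free _ E.pt <|
      (congrArg (P.act _) (LoopSpace.apply_zero (x := E.pt) (a x)).symm).trans
        ((hk' (x, 0)).trans (LoopSpace.apply_zero (x := E.pt) (b x)))).trans
          PointedGroup.pt_eq_one.symm
    have h1 : ∀ x, k (x, 1) = K.pt := fun x => (P.free _ E.pt <|
      (congrArg (P.act _) (LoopSpace.apply_one (x := E.pt) (a x)).symm).trans
        ((hk' (x, 1)).trans (LoopSpace.apply_one (x := E.pt) (b x)))).trans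
          PointedGroup.pt_eq_one.symm
    exact ⟨fun x => LoopSpace.mk (fun t => k (x, t))
      (hk.comp (dSmooth_const.prodMk dSmooth_id)) (h0 x) (h1 x),
      (LoopSpace.dSmooth_iff.2 hk).isPlot, fun x => LoopSpace.ext fun t => hk' (x, t)⟩
  exists_lift_plot n f hf e he := by
    obtain ⟨g, hg, hgf, hg0⟩ := P.exists_lift_loop hf.dSmooth 0 (e := e) fun t =>
      congrArg (fun γ : LoopSpace B.carrier B.pt => γ t) he
    exact ⟨g, hg.isPlot, fun x => LoopSpace.ext fun t => hgf x t, hg0⟩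

/-- The iterated loop spaces of a principal fibration. -/
def iterLoop : ∀ n, PrincipalFibration (K.iterLoop n) (E.iterLoop n) (B.iterLoop n)
  | 0 => P
  | n + 1 => (iterLoop n).loop

end PrincipalFibration

/-! ### The boundary map and the long exact sequence of a principal fibration -/

theorem Pi0.mk_eq_mk {X : Type*} [DiffeologicalSpace X] {x y : X} :
    Pi0.mk x = Pi0.mk y ↔ ∃ γ : ℝ → X, DSmooth γ ∧ γ 0 = x ∧ γ 1 = y :=
  Quotient.eq (r := pathSetoid X)

theorem Pi0.exists_rep {X : Type*} [DiffeologicalSpace X] (a : Pi0 X) : ∃ x, Pi0.mk x = a :=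
  Quotient.exists_rep a

theorem DSmooth.pi0_eq {X Y : Type*} [DiffeologicalSpace X] [DiffeologicalSpace Y] {f : X → Y}
    (hf : DSmooth f) {x y : X} (h : Pi0.mk x = Pi0.mk y) : Pi0.mk (f x) = Pi0.mk (f y) := by
  obtain ⟨γ, hγ, h0, h1⟩ := Pi0.mk_eq_mk.1 h
  exact Pi0.mk_eq_mk.2 ⟨fun t => f (γ t), hf.comp hγ, congrArg f h0, congrArg f h1⟩

/-- Pointwise multiplication of the path components of a group. -/
def PointedGroup.pi0Mul (K : Pointed.{u}) [PointedGroup K] :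
    Pi0 K.carrier → Pi0 K.carrier → Pi0 K.carrier :=
  Quotient.map₂ (· * ·) fun _ _ ⟨γ, hγ, h0, h1⟩ _ _ ⟨δ, hδ, k0, k1⟩ =>
    ⟨fun t => γ t * δ t, hγ.mul hδ, by simp [h0, k0], by simp [h1, k1]⟩

namespace PrincipalFibration

variable {K : Pointed.{u}} {E : Pointed.{v}} {B : Pointed.{w}} [PointedGroup K]
  (P : PrincipalFibration K E B)

/-- The inclusion of the fibre through the base point. -/
def incl : PointedMap K E where
  toFun k := P.act k E.pt
  smooth := P.act_dSmooth dSmooth_id dSmooth_const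
  map_pt := by rw [PointedGroup.pt_eq_one, P.one_act]

/-- The loop `γ` lifts to a path from the base point to its translate by `k`. -/
def IsBoundary (γ : LoopSpace B.carrier B.pt) (k : K.carrier) : Prop :=
  ∃ g : ℝ → E.carrier, DSmooth g ∧ (∀ t, P.proj.toFun (g t) = γ t) ∧ g 0 = E.pt ∧
    g 1 = P.act k E.pt

theorem exists_isBoundary (γ : LoopSpace B.carrier B.pt) : ∃ k, P.IsBoundary γ k := by
  obtain ⟨g, hg, hgγ, hg0⟩ := P.exists_lift γ.smooth 0 (e := E.pt) (by simp [P.proj.map_pt])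
  obtain ⟨k, hk⟩ := P.exists_act_eq (a := E.pt) (b := g 1) (by simp [hgγ, P.proj.map_pt])
  exact ⟨k, g, hg, hgγ, hg0, hk.symm⟩

variable {P}

/-- A homotopy of loops lifts to a square. Once the edge t = 0 is moved to the base point by a, the
edge t = 1 is b(s) · pt for a path b in K, and k, k' are joined to the two ends of b. -/
theorem IsBoundary.pi0_eq {γ γ' : LoopSpace B.carrier B.pt} {k k' : K.carrier}
    (h : P.IsBoundary γ k) (h' : P.IsBoundary γ' k') (hγ : Pi0.mk γ = Pi0.mk γ') :
    Pi0.mk k = Pi0.mk k' := by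
  obtain ⟨g, hg, hgγ, hg0, hg1⟩ := h
  obtain ⟨g', hg', hgγ', hg0', hg1'⟩ := h'
  obtain ⟨H, hH, rfl, rfl⟩ := Pi0.mk_eq_mk.1 hγ
  obtain ⟨L, hL, hLH, hL0⟩ := P.exists_lift (LoopSpace.dSmooth_iff.1 hH) (0, 0) (e := E.pt)
    (by simp [P.proj.map_pt])
  have hs : ∀ c : ℝ, DSmooth fun x : ℝ => ((x, c) : ℝ × ℝ) := fun c =>
    dSmooth_id.prodMk dSmooth_const
  have ht : ∀ c : ℝ, DSmooth fun x : ℝ => ((c, x) : ℝ × ℝ) := fun c =>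
    dSmooth_const.prodMk dSmooth_id
  obtain ⟨a, ha, ha'⟩ := P.exists_div (hL.comp (hs 0)) (dSmooth_const (y := E.pt)) fun x => by
    simp [hLH, P.proj.map_pt]
  obtain ⟨b, hb, hb'⟩ := P.exists_div (dSmooth_const (y := E.pt))
    (P.act_dSmooth ha (hL.comp (hs 1))) fun x => by
      simp [hLH, P.proj.map_pt, P.proj_act]
  -- two lifts of a loop that start at the base point have equivalent ends
  have key : ∀ {f : ℝ → E.carrier} {s : ℝ} {l : K.carrier}, DSmooth f →
      (∀ t, P.proj.toFun (f t) = H s t) → f 0 = E.pt → f 1 = P.act l E.pt →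
      Pi0.mk l = Pi0.mk (b s) := by
    intro f s l hf hfH hf0 hf1
    have hLs : DSmooth fun t => P.act (a s) (L (s, t)) :=
      P.act_dSmooth dSmooth_const (hL.comp (ht s))
    obtain ⟨c, hc, hc'⟩ := P.exists_div hf hLs fun t => by simp [hfH, P.proj_act, hLH]
    -- The quotient c of the two lifts is 1 at t = 0; at t = 1 it carries l · pt to b(s) · pt. So
    -- c(t) l runs from l to b(s).
    refine Pi0.mk_eq_mk.2 ⟨fun t => c t * l, hc.mul dSmooth_const, ?_, ?_⟩
    · have : c 0 = 1 := P.free _ E.pt <| by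
        have := hc' 0
        rw [hf0] at this
        exact this.trans (ha' s)
      simp [this]
    · refine P.act_left_injective (a := E.pt) ?_
      rw [P.mul_act, ← hf1]
      exact (hc' 1).trans (hb' s).symm
  refine (key hg hgγ hg0 hg1).trans (Eq.trans ?_ (key hg' hgγ' hg0' hg1').symm)
  exact Pi0.mk_eq_mk.2 ⟨b, hb, rfl, rfl⟩

variable (P)

/-- The boundary map `π₁(B) → π₀(K)`. -/
def boundaryOne : DHomotopyGroup 1 B → DHomotopyGroup 0 K :=
  Quotient.lift (s := pathSetoid (LoopSpace B.carrier B.pt))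
    (fun γ => Pi0.mk (P.exists_isBoundary γ).choose) fun γ γ' h =>
      (P.exists_isBoundary γ).choose_spec.pi0_eq (P.exists_isBoundary γ').choose_spec
        (Quotient.sound h)

variable {P} in
theorem IsBoundary.boundaryOne_mk {γ : LoopSpace B.carrier B.pt} {k : K.carrier}
    (h : P.IsBoundary γ k) : P.boundaryOne (Pi0.mk γ) = Pi0.mk k :=
  (P.exists_isBoundary γ).choose_spec.pi0_eq h rfl

theorem exists_boundaryOne_eq (c : DHomotopyGroup 1 B) :
    ∃ (γ : LoopSpace B.carrier B.pt) (k : K.carrier), c = Pi0.mk γ ∧ P.IsBoundary γ k ∧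
      P.boundaryOne c = Pi0.mk k := by
  obtain ⟨γ, rfl⟩ := Pi0.exists_rep (X := LoopSpace B.carrier B.pt) c
  obtain ⟨k, hk⟩ := P.exists_isBoundary γ
  exact ⟨γ, k, rfl, hk, hk.boundaryOne_mk⟩

-- The second lift, translated by k, starts where the first one ends and finishes at k k' · pt.
variable {P} in
theorem IsBoundary.comp {γ γ' : LoopSpace B.carrier B.pt} {k k' : K.carrier}
    (h : P.IsBoundary γ k) (h' : P.IsBoundary γ' k') :
    P.IsBoundary (γ.comp γ') (k * k') := by
  obtain ⟨g, hg, hgγ, hg0, hg1⟩ := h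
  obtain ⟨g', hg', hgγ', hg0', hg1'⟩ := h'
  refine ⟨concat g fun t => P.act k (g' t), hg.concat (P.act_dSmooth dSmooth_const hg')
    (by rw [hg1, hg0']), fun t => ?_, by simp [hg0], by simp [hg1', P.mul_act]⟩
  change _ = concat γ γ' t
  simp only [concat]
  split_ifs
  · exact hgγ _
  · exact (P.proj_act _ _).trans (hgγ' _)

theorem boundaryOne_mul (a b : DHomotopyGroup (0 + 1) B) :
    P.boundaryOne (a * b) = PointedGroup.pi0Mul K (P.boundaryOne a) (P.boundaryOne b) := by
  obtain ⟨γ, k, ha, hk, hak⟩ := P.exists_boundaryOne_eq a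
  obtain ⟨δ, l, hb, hl, hbl⟩ := P.exists_boundaryOne_eq b
  rw [hak, hbl, ha, hb]
  exact (hk.comp hl).boundaryOne_mk

/-- A path in E from pt to k · pt is exactly a lift, with boundary k, of the loop to which it
projects. -/
theorem map_zero_incl_eq_base (b : DHomotopyGroup 0 K) :
    DHomotopyGroup.map 0 P.incl b = DHomotopyGroup.base 0 E ↔ b ∈ Set.range P.boundaryOne := by
  obtain ⟨k, rfl⟩ := Pi0.exists_rep (X := K.carrier) b
  constructor
  · intro h
    obtain ⟨σ, hσ, h0, h1⟩ := Pi0.mk_eq_mk.1 (Eq.symm h)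
    have e1 : σ 1 = P.act k E.pt := h1
    refine ⟨Pi0.mk (LoopSpace.mk (fun t => P.proj.toFun (σ t)) (P.proj.smooth.comp hσ) ?_ ?_),
      IsBoundary.boundaryOne_mk ⟨σ, hσ, fun t => rfl, h0, e1⟩⟩
    · exact (congrArg _ h0).trans P.proj.map_pt
    · exact (congrArg _ e1).trans ((P.proj_act _ _).trans P.proj.map_pt)
  · rintro ⟨c, hc⟩
    obtain ⟨γ, l, -, ⟨g, hg, -, hg0, hg1⟩, hl⟩ := P.exists_boundaryOne_eq c
    refine (P.incl.smooth.pi0_eq (hc.symm.trans hl)).trans (Eq.symm ?_)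
    exact Pi0.mk_eq_mk.2 ⟨g, hg, hg0, hg1⟩

/-- A path in B from the image of a to the base point lifts to a path that starts at a and ends in
the base fibre, which is the orbit of pt. -/
theorem map_zero_proj_eq_base (b : DHomotopyGroup 0 E) :
    DHomotopyGroup.map 0 P.proj b = DHomotopyGroup.base 0 B ↔
      b ∈ Set.range (DHomotopyGroup.map 0 P.incl) := by
  obtain ⟨a, rfl⟩ := Pi0.exists_rep (X := E.carrier) b
  constructor
  · intro h
    obtain ⟨σ, hσ, h0, h1⟩ := Pi0.mk_eq_mk.1 h
    obtain ⟨g, hg, hgσ, hg0⟩ := P.exists_lift hσ 0 (e := a) h0.symm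
    obtain ⟨k, hk⟩ := P.exists_act_eq (a := E.pt) (b := g 1) (by
      rw [hgσ, P.proj.map_pt]; exact h1.symm)
    refine ⟨Pi0.mk k, Eq.symm ?_⟩
    exact Pi0.mk_eq_mk.2 ⟨g, hg, hg0, hk.symm⟩
  · rintro ⟨k, hk⟩
    obtain ⟨k, rfl⟩ := Pi0.exists_rep (X := K.carrier) k
    rw [← hk]
    exact congrArg Pi0.mk ((P.proj_act k E.pt).trans P.proj.map_pt)

/-- If κ joins 1 to k in K and the lift g of γ ends at k · pt, then κ(t)⁻¹ · g(t) is a loop in E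
over γ. -/
theorem boundaryOne_eq_base (c : DHomotopyGroup 1 B) :
    P.boundaryOne c = DHomotopyGroup.base 0 K ↔
      c ∈ Set.range (DHomotopyGroup.map 1 P.proj) := by
  constructor
  · intro h
    obtain ⟨γ, k, rfl, ⟨g, hg, hgγ, hg0, hg1⟩, hk⟩ := P.exists_boundaryOne_eq c
    obtain ⟨κ, hκ, h0, h1⟩ := (Pi0.mk_eq_mk (X := K.carrier)).1 (h.symm.trans hk)
    replace h0 : κ 0 = 1 := h0.trans PointedGroup.pt_eq_one
    refine ⟨Pi0.mk (X := LoopSpace E.carrier E.pt) (LoopSpace.mk (fun t => P.act (κ t)⁻¹ (g t))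
      (P.act_dSmooth hκ.inv hg) ?_ ?_), congrArg Pi0.mk (LoopSpace.ext fun t => ?_)⟩
    · rw [h0, hg0, inv_one, P.one_act]
    · rw [show κ 1 = k from h1, hg1, P.act_inv_act]
    · exact (P.proj_act _ _).trans (hgγ t)
  · rintro ⟨e, he⟩
    obtain ⟨e, rfl⟩ := Pi0.exists_rep (X := LoopSpace E.carrier E.pt) e
    rw [← he]
    refine (IsBoundary.boundaryOne_mk (P := P) (k := 1) ?_).trans
      (congrArg Pi0.mk PointedGroup.pt_eq_one.symm)
    exact ⟨e, e.smooth, fun t => rfl, e.apply_zero, e.apply_one.trans (P.one_act _).symm⟩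

/-- With its iterated versions below, this turns the lowest-degree statements for `P.iterLoop n`
into statements about π_n. -/
theorem loop_incl : P.loop.incl = P.incl.loop := rfl

theorem iterLoop_incl : ∀ n, (P.iterLoop n).incl = P.incl.iterLoop n
  | 0 => rfl
  | n + 1 => by
    change (P.iterLoop n).loop.incl = (P.incl.iterLoop n).loop
    rw [loop_incl, iterLoop_incl]

theorem iterLoop_proj : ∀ n, (P.iterLoop n).proj = P.proj.iterLoop n
  | 0 => rfl
  | n + 1 => congrArg PointedMap.loop (iterLoop_proj n)

/-- The boundary map `π_{n+1}(B) → π_n(K)`. -/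
def boundary (n : ℕ) : DHomotopyGroup (n + 1) B → DHomotopyGroup n K :=
  (P.iterLoop n).boundaryOne

theorem boundary_mul (n : ℕ) (a b : DHomotopyGroup (n + 1) B) :
    P.boundary n (a * b) =
      PointedGroup.pi0Mul (K.iterLoop n) (P.boundary n a) (P.boundary n b) :=
  (P.iterLoop n).boundaryOne_mul a b

theorem boundary_one (n : ℕ) : P.boundary n 1 = DHomotopyGroup.base n K :=
  ((P.iterLoop n).boundaryOne_eq_base _).2
    ⟨1, congrArg Pi0.mk (LoopSpace.ext fun _ => (P.iterLoop n).proj.map_pt)⟩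

/-- Exactness at `π_n(K)`. -/
theorem map_incl_eq_base (n : ℕ) (b : DHomotopyGroup n K) :
    DHomotopyGroup.map n P.incl b = DHomotopyGroup.base n E ↔ b ∈ Set.range (P.boundary n) := by
  have := (P.iterLoop n).map_zero_incl_eq_base b
  rw [iterLoop_incl] at this
  exact this

/-- Exactness at `π_n(E)`. -/
theorem map_proj_eq_base (n : ℕ) (b : DHomotopyGroup n E) :
    DHomotopyGroup.map n P.proj b = DHomotopyGroup.base n B ↔
      b ∈ Set.range (DHomotopyGroup.map n P.incl) := by
  have := (P.iterLoop n).map_zero_proj_eq_base b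
  rw [iterLoop_incl, iterLoop_proj] at this
  exact this

/-- Exactness at `π_{n+1}(B)`. -/
theorem boundary_eq_base (n : ℕ) (c : DHomotopyGroup (n + 1) B) :
    P.boundary n c = DHomotopyGroup.base n K ↔
      c ∈ Set.range (DHomotopyGroup.map (n + 1) P.proj) := by
  have := (P.iterLoop n).boundaryOne_eq_base c
  rw [iterLoop_proj] at this
  exact this

/-- The boundary maps of a principal fibration with weakly contractible total space are
bijective. -/
theorem boundary_bijective (hE : ∀ n, Subsingleton (DHomotopyGroup n E)) (n : ℕ) :
    Function.Bijective (P.boundary n) := by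
  have := hE n
  have := hE (n + 1)
  refine ⟨fun a b h => ?_, fun b => (P.map_incl_eq_base n b).1 (Subsingleton.elim _ _)⟩
  -- Multiplicativity reduces injectivity to triviality of the kernel, and the kernel is the image
  -- of a one-point set.
  have h1 : P.boundary n (a⁻¹ * b) = DHomotopyGroup.base n K := by
    rw [boundary_mul, ← h, ← boundary_mul, inv_mul_cancel, boundary_one]
  obtain ⟨e, he⟩ := (P.boundary_eq_base n _).1 h1
  have h2 : a⁻¹ * b = 1 := by
    rw [← he, Subsingleton.elim e (DHomotopyGroup.base (n + 1) E), ← DHomotopyGroup.base_succ]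
    exact congrArg Pi0.mk (P.proj.iterLoop (n + 1)).map_pt
  exact inv_mul_eq_one.1 h2

/-! ### Naturality of the boundary maps -/

/-- A morphism of principal fibrations. -/
structure Hom {K' : Pointed.{u'}} {E' : Pointed.{v'}} {B' : Pointed.{w'}} [PointedGroup K']
    (P : PrincipalFibration K E B) (P' : PrincipalFibration K' E' B') where
  /-- The map of groups. -/
  group : PointedMap K K'
  /-- The map of total spaces. -/
  total : PointedMap E E'
  /-- The map of base spaces. -/
  base : PointedMap B B'
  total_act : ∀ k a, total.toFun (P.act k a) = P'.act (group.toFun k) (total.toFun a)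
  base_proj : ∀ a, base.toFun (P.proj.toFun a) = P'.proj.toFun (total.toFun a)

namespace Hom

variable {P} {K' : Pointed.{u'}} {E' : Pointed.{v'}} {B' : Pointed.{w'}} [PointedGroup K']
  {P' : PrincipalFibration K' E' B'} (φ : Hom P P')

/-- The morphism of loop spaces. -/
def loop : Hom P.loop P'.loop where
  group := φ.group.loop
  total := φ.total.loop
  base := φ.base.loop
  total_act _ _ := LoopSpace.ext fun _ => φ.total_act _ _
  base_proj _ := LoopSpace.ext fun _ => φ.base_proj _

/-- The morphism of iterated loop spaces. -/
def iterLoop : ∀ n, Hom (P.iterLoop n) (P'.iterLoop n)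
  | 0 => φ
  | n + 1 => (iterLoop n).loop

theorem iterLoop_group : ∀ n, (φ.iterLoop n).group = φ.group.iterLoop n
  | 0 => rfl
  | n + 1 => congrArg PointedMap.loop (iterLoop_group n)

theorem iterLoop_base : ∀ n, (φ.iterLoop n).base = φ.base.iterLoop n
  | 0 => rfl
  | n + 1 => congrArg PointedMap.loop (iterLoop_base n)

/-- The map of total spaces sends a lift ending at k · pt to a lift of the image loop ending at the
translate by the image of k. -/
theorem boundaryOne_map (c : DHomotopyGroup 1 B) :
    P'.boundaryOne (DHomotopyGroup.map 1 φ.base c) =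
      DHomotopyGroup.map 0 φ.group (P.boundaryOne c) := by
  obtain ⟨γ, k, hc, ⟨g, hg, hgγ, hg0, hg1⟩, hk⟩ := P.exists_boundaryOne_eq c
  rw [hk, hc]
  refine IsBoundary.boundaryOne_mk ⟨fun t => φ.total.toFun (g t), φ.total.smooth.comp hg,
    fun t => ?_, ?_, ?_⟩
  · rw [← φ.base_proj, hgγ]
    rfl
  · exact (congrArg _ hg0).trans φ.total.map_pt
  · exact (congrArg _ hg1).trans ((φ.total_act _ _).trans (congrArg _ φ.total.map_pt))

/-- The boundary maps are natural. -/
theorem boundary_map (n : ℕ) (c : DHomotopyGroup (n + 1) B) :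
    P'.boundary n (DHomotopyGroup.map (n + 1) φ.base c) =
      DHomotopyGroup.map n φ.group (P.boundary n c) := by
  have := (φ.iterLoop n).boundaryOne_map c
  rw [iterLoop_base, iterLoop_group] at this
  exact this

end Hom

end PrincipalFibration

/-! ### Concatenation and pointwise product of loops in a group -/

/-- The product of loops in a group may be computed pointwise. -/
theorem DHomotopyGroup.mul_eq_pi0Mul (K : Pointed.{u}) [PointedGroup K]
    (a b : DHomotopyGroup (0 + 1) K) : a * b = PointedGroup.pi0Mul K.loop a b := by
  -- The Eckmann–Hilton argument: after padding to a · 1 and 1 · b, one of the two factors is the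
  -- unit on each half of the interval, so their pointwise product is the concatenation of a and b.
  have ha : a * 1 = a := mul_one a
  have hb : 1 * b = b := one_mul b
  conv_rhs => rw [← ha, ← hb]
  obtain ⟨a, rfl⟩ := Pi0.exists_rep (X := LoopSpace K.carrier K.pt) a
  obtain ⟨b, rfl⟩ := Pi0.exists_rep (X := LoopSpace K.carrier K.pt) b
  refine congrArg Pi0.mk (LoopSpace.ext fun t => ?_)
  change concat a b t = concat a (fun _ => K.pt) t * concat (fun _ => K.pt) b t
  simp only [concat, PointedGroup.pt_eq_one]
  split_ifs <;> simp

theorem DHomotopyGroup.mul_eq_pi0Mul_iterLoop (K : Pointed.{u}) [PointedGroup K] (n : ℕ)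
    (a b : DHomotopyGroup (n + 1) K) :
    a * b = PointedGroup.pi0Mul (K.iterLoop (n + 1)) a b :=
  DHomotopyGroup.mul_eq_pi0Mul (K.iterLoop n) a b

/-! ### Free contractions and loop spaces -/

/-- The identity of `E` is smoothly homotopic to the constant map at the base point (the homotopy
need not fix the base point). -/
def Pointed.SmoothlyContractible (E : Pointed.{u}) : Prop :=
  ∃ H : ℝ × E.carrier → E.carrier, DSmooth H ∧ (∀ x, H (0, x) = x) ∧ ∀ x, H (1, x) = E.pt

namespace Pointed.SmoothlyContractible

variable {E : Pointed.{u}}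

theorem subsingleton_pi0 (h : E.SmoothlyContractible) : Subsingleton (Pi0 E.carrier) := by
  obtain ⟨H, hH, h0, h1⟩ := h
  have key : ∀ a : Pi0 E.carrier, a = Pi0.mk E.pt := by
    intro a
    obtain ⟨x, rfl⟩ := Pi0.exists_rep a
    exact Pi0.mk_eq_mk.2 ⟨fun t => H (t, x), hH.comp (dSmooth_id.prodMk dSmooth_const),
      h0 x, h1 x⟩
  exact ⟨fun a b => (key a).trans (key b).symm⟩

/-- The loop is first pushed to the boundary of the square `(s, t) ↦ H (s, γ t)`, where it becomes
independent of `γ`. -/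
theorem loop (h : E.SmoothlyContractible) : E.loop.SmoothlyContractible := by
  obtain ⟨H, hH, h0, h1⟩ := h
  -- τ is 0 on the first third of the interval and 1 on the last, and s is 1 on the middle third.
  -- Hence H(s t, γ(τ t)) either reads γ at an end or is the base point, so it equals H(s t, pt).
  let s : ℝ → ℝ := fun t => smash (3 * t) * (1 - smash (3 * t - 2))
  let τ : ℝ → ℝ := fun t => smash (3 * t - 1)
  have hs : ContDiff ℝ ∞ s :=
    (smash_contDiff.comp (contDiff_const.mul contDiff_id)).mul (contDiff_const.sub
      (smash_contDiff.comp ((contDiff_const.mul contDiff_id).sub contDiff_const)))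
  have hτ : ContDiff ℝ ∞ τ :=
    smash_contDiff.comp ((contDiff_const.mul contDiff_id).sub contDiff_const)
  have hs0 : s 0 = 0 := by simp [s, LoopSpace.smash_zero]
  have hs1 : s 1 = 0 := by
    simp only [s]
    rw [smash_of_ge (t := 3 * 1 - 2) (by norm_num)]
    ring
  have hτ0 : τ 0 = 0 := smash_of_le (by norm_num)
  have hτ1 : τ 1 = 1 := smash_of_ge (by norm_num)
  have hsτ : ∀ t, τ t = 0 ∨ τ t = 1 ∨ s t = 1 := by
    intro t
    rcases le_total t (1 / 3) with h | h
    · exact Or.inl (smash_of_le (by linarith))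
    rcases le_total (2 / 3) t with h' | h'
    · exact Or.inr (Or.inl (smash_of_ge (by linarith)))
    · refine Or.inr (Or.inr ?_)
      simp only [s]
      rw [smash_of_ge (by linarith), smash_of_le (by linarith)]
      ring
  let Ω := LoopSpace E.carrier E.pt
  have hparam : DSmooth fun q : (Ω × ℝ) × ℝ => (1 - q.1.2) * q.2 + q.1.2 * τ q.2 := by
    intro m p hp
    have h1 := IsPlot.contDiff hp.1.2
    have h2 := IsPlot.contDiff hp.2
    exact ContDiff.isPlot (((contDiff_const.sub h1).mul h2).add (h1.mul (hτ.comp h2)))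
  have hus : DSmooth fun q : (Ω × ℝ) × ℝ => q.1.2 * s q.2 := by
    intro m p hp
    have h1 := IsPlot.contDiff hp.1.2
    have h2 := IsPlot.contDiff hp.2
    exact ContDiff.isPlot (h1.mul (hs.comp h2))
  have hus' : DSmooth fun q : (Ω × ℝ) × ℝ => (1 - q.1.2) * s q.2 := by
    intro m p hp
    have h1 := IsPlot.contDiff hp.1.2
    have h2 := IsPlot.contDiff hp.2
    exact ContDiff.isPlot ((contDiff_const.sub h1).mul (hs.comp h2))
  have hA : DSmooth fun q : (Ω × ℝ) × ℝ =>
      H (q.1.2 * s q.2, q.1.1 ((1 - q.1.2) * q.2 + q.1.2 * τ q.2)) :=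
    hH.comp (hus.prodMk
      (LoopSpace.smooth_eval (x := E.pt) (dSmooth_fst.comp dSmooth_fst) hparam))
  have hB : DSmooth fun q : (Ω × ℝ) × ℝ => H ((1 - q.1.2) * s q.2, E.pt) :=
    hH.comp (hus'.prodMk dSmooth_const)
  have hW : ∀ q : Ω × ℝ, DSmooth fun t : ℝ => (q, t) := fun q =>
    dSmooth_const.prodMk dSmooth_id
  -- A deforms γ to the loop t ↦ H(s t, pt), which runs along the track of the base point and back;
  -- B retracts this loop along the track to the constant loop.
  let A : Ω → ℝ → Ω := fun γ u => LoopSpace.mk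
    (fun t => H (u * s t, γ ((1 - u) * t + u * τ t))) (hA.comp (hW (γ, u)))
    (by simp [hs0, hτ0, h0]) (by simp [hs1, hτ1, h0])
  let B : Ω → ℝ → Ω := fun γ u => LoopSpace.mk
    (fun t => H ((1 - u) * s t, E.pt)) (hB.comp (hW (γ, u)))
    (by simp [hs0, h0]) (by simp [hs1, h0])
  have hAB : DSmooth fun q : Ω × ℝ => concat (A q.1) (B q.1) q.2 := by
    refine DSmooth.concat_family (LoopSpace.dSmooth_iff.2 hA) (LoopSpace.dSmooth_iff.2 hB)
      fun γ => LoopSpace.ext fun t => ?_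
    simp only [A, B, LoopSpace.mk_apply]
    rcases hsτ t with h | h | h <;> simp [h, h1]
  refine ⟨fun q => concat (A q.2) (B q.2) q.1, hAB.comp (dSmooth_snd.prodMk dSmooth_fst), ?_, ?_⟩
  · refine fun γ => (concat_zero _ _).trans (LoopSpace.ext fun t => ?_)
    simp [A, h0]
  · refine fun γ => (concat_one _ _).trans (LoopSpace.ext fun t => ?_)
    simp only [B, LoopSpace.mk_apply, sub_self, zero_mul, h0]
    rfl

theorem iterLoop (h : E.SmoothlyContractible) : ∀ n, (E.iterLoop n).SmoothlyContractible
  | 0 => h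
  | n + 1 => (iterLoop h n).loop

theorem subsingleton_homotopyGroup (h : E.SmoothlyContractible) (n : ℕ) :
    Subsingleton (DHomotopyGroup n E) :=
  (h.iterLoop n).subsingleton_pi0

end Pointed.SmoothlyContractible

/-! ### Principal actions with local lifts are fibrations -/

/-- A smooth map into a ball that is the identity on a smaller ball. -/
theorem exists_contDiff_into_ball {V : Type*} [NormedAddCommGroup V] [InnerProductSpace ℝ V]
    [FiniteDimensional ℝ V] (c : V) {r R : ℝ} (hr : 0 < r) (hR : r < R) :
    ∃ κ : V → V, ContDiff ℝ ∞ κ ∧ (∀ x, κ x ∈ Metric.ball c R) ∧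
      ∀ x ∈ Metric.ball c r, κ x = x := by
  let χ : ContDiffBump c := ⟨r, R, hr, hR⟩
  refine ⟨fun x => c + χ x • (x - c),
    contDiff_const.add (χ.contDiff.smul (contDiff_id.sub contDiff_const)), fun x => ?_,
    fun x hx => ?_⟩
  · by_cases hx : x ∈ Metric.ball c R
    · rw [Metric.mem_ball, dist_eq_norm] at hx ⊢
      rw [add_sub_cancel_left, norm_smul, Real.norm_eq_abs, abs_of_nonneg χ.nonneg]
      calc χ x * ‖x - c‖ ≤ 1 * ‖x - c‖ := by gcongr; exact χ.le_one
        _ < R := by rwa [one_mul]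
    · have : χ x = 0 := χ.zero_of_le_dist (by simpa using hx)
      simp [this, hr.trans hR]
  · have : χ x = 1 := χ.one_of_mem_closedBall (Metric.ball_subset_closedBall hx)
    simp [this]

section PlotOn

variable {X : Type*} [DiffeologicalSpace X] {n : ℕ}

/-- The map agrees with a plot near every point of `S`. -/
def IsPlotOn (g : EuclideanSpace ℝ (Fin n) → X) (S : Set (EuclideanSpace ℝ (Fin n))) : Prop :=
  ∀ x ∈ S, ∃ q : EuclideanSpace ℝ (Fin n) → X, IsPlot q ∧ q =ᶠ[𝓝 x] g

theorem IsPlotOn.comp {g : EuclideanSpace ℝ (Fin n) → X} {S T : Set (EuclideanSpace ℝ (Fin n))}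
    (hg : IsPlotOn g S) {κ : EuclideanSpace ℝ (Fin n) → EuclideanSpace ℝ (Fin n)}
    (hκ : ContDiff ℝ ∞ κ) (h : ∀ x ∈ T, κ x ∈ S) : IsPlotOn (fun x => g (κ x)) T := fun x hx => by
  obtain ⟨q, hq, hqg⟩ := hg (κ x) (h x hx)
  exact ⟨q ∘ κ, isPlot_reparam hq hκ, hκ.continuous.continuousAt.eventually hqg⟩

theorem IsPlotOn.isPlot_comp {g : EuclideanSpace ℝ (Fin n) → X}
    {S : Set (EuclideanSpace ℝ (Fin n))} (hg : IsPlotOn g S)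
    {κ : EuclideanSpace ℝ (Fin n) → EuclideanSpace ℝ (Fin n)} (hκ : ContDiff ℝ ∞ κ)
    (h : ∀ x, κ x ∈ S) : IsPlot fun x => g (κ x) :=
  isPlot_of_eventuallyEq fun x => hg.comp (T := Set.univ) hκ (fun x _ => h x) x trivial

end PlotOn

/-- An open box in a Euclidean space. -/
def openBox {n : ℕ} (l u : Fin n → ℝ) : Set (EuclideanSpace ℝ (Fin n)) :=
  {x | ∀ j, l j < x j ∧ x j < u j}

theorem isOpen_openBox {n : ℕ} (l u : Fin n → ℝ) : IsOpen (openBox l u) := by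
  simp only [openBox, Set.ofPred_forall]
  refine isOpen_iInter_of_finite fun j => ?_
  have hj : Continuous fun x : EuclideanSpace ℝ (Fin n) => x j := by fun_prop
  exact (isOpen_lt continuous_const hj).inter (isOpen_lt hj continuous_const)

namespace PrincipalAction

variable {K : Pointed.{u}} {E : Pointed.{v}} {B : Pointed.{w}} [PointedGroup K]
  (P : PrincipalAction K E B) {n : ℕ}

/-- The map `f` lifts to the total space over `S`. -/
def LiftsOn (f : EuclideanSpace ℝ (Fin n) → B.carrier) (S : Set (EuclideanSpace ℝ (Fin n))) :
    Prop :=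
  ∃ g : EuclideanSpace ℝ (Fin n) → E.carrier, IsPlotOn g S ∧ ∀ x ∈ S, P.proj.toFun (g x) = f x

theorem exists_div_on {S : Set (EuclideanSpace ℝ (Fin n))} (hS : IsOpen S)
    {a b : EuclideanSpace ℝ (Fin n) → E.carrier} (ha : IsPlotOn a S) (hb : IsPlotOn b S)
    (h : ∀ x ∈ S, P.proj.toFun (a x) = P.proj.toFun (b x)) :
    ∃ k : EuclideanSpace ℝ (Fin n) → K.carrier, IsPlotOn k S ∧
      ∀ x ∈ S, P.act (k x) (a x) = b x := by
  have h' : ∀ x, ∃ k, x ∈ S → P.act k (a x) = b x := fun x => by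
    by_cases hx : x ∈ S
    · obtain ⟨k, hk⟩ := P.exists_act_eq (h x hx)
      exact ⟨k, fun _ => hk⟩
    · exact ⟨1, fun hx' => absurd hx' hx⟩
  choose k hk using h'
  refine ⟨k, fun x hx => ?_, hk⟩
  obtain ⟨κ, hκ, hκS, hκx⟩ := exists_smooth_into hS hx
  obtain ⟨l, hl, hl'⟩ := P.exists_div_plot n _ _ (ha.isPlot_comp hκ hκS) (hb.isPlot_comp hκ hκS)
    fun y => h _ (hκS y)
  refine ⟨l, hl, ?_⟩
  filter_upwards [hκx] with y hy
  have := hl' y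
  rw [hy] at this
  exact P.act_left_injective (this.trans (hk y (hy ▸ hκS y)).symm)

theorem act_isPlotOn {S : Set (EuclideanSpace ℝ (Fin n))}
    {k : EuclideanSpace ℝ (Fin n) → K.carrier} {a : EuclideanSpace ℝ (Fin n) → E.carrier}
    (hk : IsPlotOn k S) (ha : IsPlotOn a S) : IsPlotOn (fun x => P.act (k x) (a x)) S :=
  fun x hx => by
    obtain ⟨l, hl, hlk⟩ := hk x hx
    obtain ⟨b, hb, hba⟩ := ha x hx
    refine ⟨fun x => P.act (l x) (b x), (P.act_dSmooth hl.dSmooth hb.dSmooth).isPlot, ?_⟩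
    filter_upwards [hlk, hba] with y h1 h2
    rw [h1, h2]

/-- Lifts over two overlapping boxes can be glued. -/
theorem LiftsOn.glue {f : EuclideanSpace ℝ (Fin n) → B.carrier} {l u : Fin n → ℝ} {i : Fin n}
    {c ε : ℝ} (hε : 0 < ε) (hl : l i ≤ c - ε) (hu : c + ε ≤ u i)
    (h₁ : P.LiftsOn f (openBox l (Function.update u i (c + ε))))
    (h₂ : P.LiftsOn f (openBox (Function.update l i (c - ε)) u)) :
    P.LiftsOn f (openBox l u) := by
  obtain ⟨g₁, hg₁, hf₁⟩ := h₁
  obtain ⟨g₂, hg₂, hf₂⟩ := h₂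
  have m₁ : ∀ {x}, x ∈ openBox l (Function.update u i (c + ε)) ↔
      x ∈ openBox l u ∧ x i < c + ε := by
    intro x
    constructor
    · intro hx
      have hi := (hx i).2
      rw [Function.update_self] at hi
      refine ⟨fun j => ⟨(hx j).1, ?_⟩, hi⟩
      rcases eq_or_ne j i with rfl | hj
      · exact hi.trans_le hu
      · simpa [hj] using (hx j).2
    · rintro ⟨hx, hi⟩ j
      refine ⟨(hx j).1, ?_⟩
      rcases eq_or_ne j i with rfl | hj
      · simpa using hi
      · simpa [hj] using (hx j).2
  have m₂ : ∀ {x}, x ∈ openBox (Function.update l i (c - ε)) u ↔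
      x ∈ openBox l u ∧ c - ε < x i := by
    intro x
    constructor
    · intro hx
      have hi := (hx i).1
      rw [Function.update_self] at hi
      refine ⟨fun j => ⟨?_, (hx j).2⟩, hi⟩
      rcases eq_or_ne j i with rfl | hj
      · exact hl.trans_lt hi
      · simpa [hj] using (hx j).1
    · rintro ⟨hx, hi⟩ j
      refine ⟨?_, (hx j).2⟩
      rcases eq_or_ne j i with rfl | hj
      · simpa using hi
      · simpa [hj] using (hx j).1
  set U₁ := openBox l (Function.update u i (c + ε)) with hU₁
  set U₂ := openBox (Function.update l i (c - ε)) u with hU₂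
  have hO : IsOpen (U₁ ∩ U₂) := (isOpen_openBox _ _).inter (isOpen_openBox _ _)
  -- k turns g₂ into g₁ over the overlap; it remains to extend it over U₂ without changing it near
  -- the wall x i = c.
  obtain ⟨k, hk, hk'⟩ := P.exists_div_on hO (a := g₂) (b := g₁) (fun x hx => hg₂ x hx.2)
    (fun x hx => hg₁ x hx.1) fun x hx => (hf₂ x hx.2).trans (hf₁ x hx.1).symm
  obtain ⟨η, hη, hηm, hηc⟩ := exists_contDiff_into_ball c (half_pos hε) (half_lt_self hε)
  -- κ pushes the i-th coordinate into (c − ε, c + ε) and fixes points within ε / 2 of the wall.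
  -- Thus k ∘ κ is defined on all of U₂ and equals k near the wall.
  let κ : EuclideanSpace ℝ (Fin n) → EuclideanSpace ℝ (Fin n) := fun x =>
    x + (η (x i) - x i) • EuclideanSpace.single i (1 : ℝ)
  have hxi : ContDiff ℝ ∞ fun x : EuclideanSpace ℝ (Fin n) => x i := by fun_prop
  have hκ : ContDiff ℝ ∞ κ :=
    contDiff_id.add (((hη.comp hxi).sub hxi).smul contDiff_const)
  have hκi : ∀ x, κ x i = η (x i) := fun x => by simp [κ]
  have hκj : ∀ x j, j ≠ i → κ x j = x j := fun x j hj => by simp [κ, hj]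
  have hκU : ∀ x ∈ U₂, κ x ∈ U₁ ∩ U₂ := by
    intro x hx
    have hb := hηm (x i)
    rw [Metric.mem_ball, Real.dist_eq, abs_lt] at hb
    have hx' := (m₂.1 hx).1
    have hκx : κ x ∈ openBox l u := fun j => by
      rcases eq_or_ne j i with rfl | hj
      · rw [hκi]
        constructor <;> linarith [hb.1, hb.2]
      · rw [hκj x j hj]
        exact hx' j
    exact ⟨m₁.2 ⟨hκx, by rw [hκi]; linarith [hb.2]⟩, m₂.2 ⟨hκx, by rw [hκi]; linarith [hb.1]⟩⟩
  have hkg := P.act_isPlotOn (hk.comp hκ hκU) hg₂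
  have hic : Continuous fun x : EuclideanSpace ℝ (Fin n) => x i := hxi.continuous
  refine ⟨fun x => if x i ≤ c then g₁ x else P.act (k (κ x)) (g₂ x), fun x hx => ?_,
    fun x hx => ?_⟩
  · rcases lt_trichotomy (x i) c with hc | hc | hc
    · obtain ⟨q, hq, hqg⟩ := hg₁ x (m₁.2 ⟨hx, by linarith⟩)
      refine ⟨q, hq, ?_⟩
      filter_upwards [hqg, hic.continuousAt.eventually (gt_mem_nhds hc)] with y h1 h2
      rw [h1, if_pos h2.le]
    · have hxO : x ∈ U₁ ∩ U₂ := ⟨m₁.2 ⟨hx, by linarith⟩, m₂.2 ⟨hx, by linarith⟩⟩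
      obtain ⟨q, hq, hqg⟩ := hg₁ x hxO.1
      refine ⟨q, hq, ?_⟩
      have hnear : ∀ᶠ y : EuclideanSpace ℝ (Fin n) in 𝓝 x, y i ∈ Metric.ball c (ε / 2) :=
        hic.continuousAt.eventually (Metric.isOpen_ball.mem_nhds (by simp [hc, hε]))
      filter_upwards [hqg, hO.mem_nhds hxO, hnear] with y h1 h2 h3
      have : κ y = y := by simp [κ, hηc _ h3]
      rw [h1, this, hk' y h2, ite_self]
    · obtain ⟨q, hq, hqg⟩ := hkg x (m₂.2 ⟨hx, by linarith⟩)
      refine ⟨q, hq, ?_⟩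
      filter_upwards [hqg, hic.continuousAt.eventually (lt_mem_nhds hc)] with y h1 h2
      rw [h1, if_neg (not_le.2 h2)]
  · dsimp only
    split_ifs with hc
    · exact hf₁ x (m₁.2 ⟨hx, by linarith⟩)
    · rw [P.proj_act]
      exact hf₂ x (m₂.2 ⟨hx, by linarith⟩)

/-- A map that lifts locally lifts over every box. -/
theorem liftsOn_openBox {f : EuclideanSpace ℝ (Fin n) → B.carrier}
    (h : ∀ x, ∃ g : EuclideanSpace ℝ (Fin n) → E.carrier,
      IsPlot g ∧ ∀ᶠ y in 𝓝 x, P.proj.toFun (g y) = f y) (R : ℝ) :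
    P.LiftsOn f (openBox (fun _ => -R) fun _ => R) := by
  choose g hg hgf using h
  choose S hSg hS hxS using fun x => eventually_nhds_iff.1 (hgf x)
  -- The Lebesgue number is taken in the sup metric, so that every box in the cube with sides at
  -- most δ lies in the domain of one local lift.
  obtain ⟨δ, hδ, hδS⟩ := lebesgue_number_lemma_of_metric
    (s := Set.Icc (fun _ : Fin n => -R) fun _ => R) (ι := Fin n → ℝ)
    (c := fun x => WithLp.toLp 2 ⁻¹' S (WithLp.toLp 2 x)) isCompact_Icc
    (fun x => (hS _).preimage (PiLp.continuous_toLp 2 _))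
    fun x _ => Set.mem_iUnion.2 ⟨x, hxS _⟩
  have small : ∀ l u : Fin n → ℝ, (∀ j, -R ≤ l j) → (∀ j, u j ≤ R) →
      (∀ j, u j - l j ≤ δ) → P.LiftsOn f (openBox l u) := by
    intro l u hl hu hlu
    rcases (openBox l u).eq_empty_or_nonempty with he | ⟨x, hx⟩
    · exact ⟨fun _ => E.pt, fun y hy => by simp [he] at hy, fun y hy => by simp [he] at hy⟩
    · obtain ⟨z, hz⟩ := hδS (WithLp.ofLp x) ⟨fun j => (hl j).trans (hx j).1.le,
        fun j => (hx j).2.le.trans (hu j)⟩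
      refine ⟨g (WithLp.toLp 2 z), fun y _ => ⟨_, hg _, Filter.EventuallyEq.rfl⟩,
        fun y hy => hSg _ y ?_⟩
      have : WithLp.ofLp y ∈ Metric.ball (WithLp.ofLp x) δ := by
        refine (dist_pi_lt_iff hδ).2 fun j => ?_
        rw [Real.dist_eq, abs_lt]
        have h1 := hx j
        have h2 := hy j
        constructor <;> linarith [hlu j, h1.1, h1.2, h2.1, h2.2]
      exact hz this
  -- s holds the directions in which the box may be longer than δ; one direction is added at a time.
  have key : ∀ s : Finset (Fin n), ∀ l u : Fin n → ℝ, (∀ j, -R ≤ l j) → (∀ j, u j ≤ R) →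
      (∀ j ∉ s, u j - l j ≤ δ) → P.LiftsOn f (openBox l u) := by
    intro s
    induction s using Finset.induction_on with
    | empty => exact fun l u hl hu hlu => small l u hl hu fun j => hlu j (by simp)
    | insert i s _ ih =>
      have step : ∀ (m : ℕ) (l u : Fin n → ℝ), (∀ j, -R ≤ l j) → (∀ j, u j ≤ R) →
          (∀ j ∉ insert i s, u j - l j ≤ δ) → u i - l i ≤ δ + m * (δ / 2) →
          P.LiftsOn f (openBox l u) := by
        intro m
        induction m with
        | zero =>
          intro l u hl hu hlu hi
          refine ih l u hl hu fun j hj => ?_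
          rcases eq_or_ne j i with rfl | hji
          · simpa using hi
          · exact hlu j (by simp [hj, hji])
        | succ m ihm =>
          intro l u hl hu hlu hi
          rcases le_total (u i - l i) δ with hle | hle
          · refine ih l u hl hu fun j hj => ?_
            rcases eq_or_ne j i with rfl | hji
            · exact hle
            · exact hlu j (by simp [hj, hji])
          · push_cast at hi
            -- The slab on top has width δ, from u i − δ to u i, while the rest stops at u i − δ /
            -- 2. They overlap in width δ / 2, and the rest is shorter by δ / 2, as the induction on
            -- m requires.
            refine LiftsOn.glue P (i := i) (c := u i - 3 * δ / 4) (ε := δ / 4) (by linarith)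
              (by linarith) (by linarith) (ihm _ _ hl (fun j => ?_) (fun j hj => ?_) ?_)
              (ih _ _ (fun j => ?_) hu fun j hj => ?_)
            · rcases eq_or_ne j i with rfl | hji
              · simp only [Function.update_self]
                linarith [hu j]
              · simpa [hji] using hu j
            · have hji : j ≠ i := fun e => hj (by simp [e])
              simpa [hji] using hlu j hj
            · simp only [Function.update_self]
              linarith
            · rcases eq_or_ne j i with rfl | hji
              · simp only [Function.update_self]
                linarith [hl j]
              · simpa [hji] using hl j
            · rcases eq_or_ne j i with rfl | hji
              · simp only [Function.update_self]
                linarith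
              · simpa [hji] using hlu j (by simp [hj, hji])
      intro l u hl hu hlu
      obtain ⟨m, hm⟩ := exists_nat_ge ((u i - l i) / (δ / 2))
      refine step m l u hl hu hlu ?_
      rw [div_le_iff₀ (by linarith)] at hm
      linarith
  exact key Finset.univ _ _ (fun _ => le_rfl) (fun _ => le_rfl) fun j hj => absurd (by simp) hj

/-- A map that lifts locally lifts globally. -/
theorem exists_lift_plot_of_local {f : EuclideanSpace ℝ (Fin n) → B.carrier}
    (h : ∀ x, ∃ g : EuclideanSpace ℝ (Fin n) → E.carrier,
      IsPlot g ∧ ∀ᶠ y in 𝓝 x, P.proj.toFun (g y) = f y) :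
    ∃ g : EuclideanSpace ℝ (Fin n) → E.carrier, IsPlot g ∧ ∀ x, P.proj.toFun (g x) = f x := by
  have onBall : ∀ m : ℕ, ∃ g : EuclideanSpace ℝ (Fin n) → E.carrier, IsPlot g ∧
      ∀ x ∈ Metric.ball (0 : EuclideanSpace ℝ (Fin n)) (m + 1), P.proj.toFun (g x) = f x := by
    intro m
    obtain ⟨g, hg, hgf⟩ := P.liftsOn_openBox h (m + 2)
    obtain ⟨κ, hκ, hκb, hκi⟩ := exists_contDiff_into_ball (0 : EuclideanSpace ℝ (Fin n))
      (r := m + 1) (R := m + 2) (by positivity) (by linarith)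
    have hbox : ∀ x ∈ Metric.ball (0 : EuclideanSpace ℝ (Fin n)) (m + 2),
        x ∈ openBox (fun _ : Fin n => -((m : ℝ) + 2)) fun _ => (m : ℝ) + 2 := by
      intro x hx j
      rw [mem_ball_zero_iff] at hx
      have := (PiLp.norm_apply_le x j).trans_lt hx
      rwa [Real.norm_eq_abs, abs_lt] at this
    refine ⟨fun x => g (κ x), hg.isPlot_comp hκ fun x => hbox _ (hκb x), fun x hx => ?_⟩
    rw [hgf _ (hbox _ (hκb x)), hκi x hx]
  let T : ℕ → Type _ := fun m => {g : EuclideanSpace ℝ (Fin n) → E.carrier // IsPlot g ∧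
      ∀ x ∈ Metric.ball (0 : EuclideanSpace ℝ (Fin n)) (m + 1), P.proj.toFun (g x) = f x}
  have step : ∀ (m : ℕ) (σ : T m), ∃ σ' : T (m + 1),
      ∀ x ∈ Metric.ball (0 : EuclideanSpace ℝ (Fin n)) m, σ'.1 x = σ.1 x := by
    rintro m ⟨σ, hσ, hσf⟩
    obtain ⟨g, hg, hgf⟩ := onBall (m + 1)
    -- Division applies to global plots with equal projections. Both σ and g lift f on the ball of
    -- radius m + 1, so both are pulled back into it by a map that is the identity on the ball of
    -- radius m.
    obtain ⟨κ, hκ, hκb, hκi⟩ := exists_contDiff_into_ball (0 : EuclideanSpace ℝ (Fin n))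
      (r := m + 1 / 2) (R := m + 1) (by positivity) (by linarith)
    have hsub : ∀ x ∈ Metric.ball (0 : EuclideanSpace ℝ (Fin n)) (m + 1),
        x ∈ Metric.ball (0 : EuclideanSpace ℝ (Fin n)) ((m + 1 : ℕ) + 1) := fun x hx =>
      Metric.ball_subset_ball (by push_cast; linarith) hx
    obtain ⟨k, hk, hk'⟩ := P.exists_div_plot n _ _ (isPlot_reparam hg hκ) (isPlot_reparam hσ hκ)
      fun x => (hgf _ (hsub _ (hκb x))).trans (hσf _ (hκb x)).symm
    refine ⟨⟨fun x => P.act (k x) (g x), (P.act_dSmooth hk.dSmooth hg.dSmooth).isPlot,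
      fun x hx => by rw [P.proj_act, hgf x hx]⟩, fun x hx => ?_⟩
    have hx' := hk' x
    simp only [Function.comp_apply] at hx'
    rwa [hκi x (Metric.ball_subset_ball (by linarith) hx)] at hx'
  choose next hnext using step
  obtain ⟨g₀, hg₀⟩ := onBall 0
  let σ : ∀ m, T m := fun m => Nat.rec (motive := T) ⟨g₀, hg₀⟩ (fun m s => next m s) m
  have hσ : ∀ m m' : ℕ, m ≤ m' → ∀ x ∈ Metric.ball (0 : EuclideanSpace ℝ (Fin n)) m,
      (σ m').1 x = (σ m).1 x := by
    intro m m' hm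
    induction m', hm using Nat.le_induction with
    | base => exact fun _ _ => rfl
    | succ m' hm ih =>
      exact fun x hx => (hnext m' (σ m') x (Metric.ball_subset_ball (by exact_mod_cast hm) hx)).trans
        (ih x hx)
  -- The stages from N x on all agree on the ball of radius N x around 0, which contains x, so stage
  -- N x already has the limiting value there.
  let N : EuclideanSpace ℝ (Fin n) → ℕ := fun x => ⌊‖x‖⌋₊ + 1
  have hN : ∀ x, x ∈ Metric.ball (0 : EuclideanSpace ℝ (Fin n)) (N x) := fun x => by
    rw [mem_ball_zero_iff]
    exact_mod_cast Nat.lt_floor_add_one ‖x‖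
  refine ⟨fun x => (σ (N x)).1 x, isPlot_of_eventuallyEq fun x => ⟨_, (σ (N x)).2.1, ?_⟩,
    fun x => (σ (N x)).2.2 x (Metric.ball_subset_ball (by linarith) (hN x))⟩
  filter_upwards [Metric.isOpen_ball.mem_nhds (hN x)] with y hy
  rw [← hσ _ _ (le_max_left (N x) (N y)) y hy, ← hσ _ _ (le_max_right (N x) (N y)) y (hN y)]

/-- A principal action whose base has local lifts of plots is a principal fibration. -/
def toFibration (h : ∀ (n : ℕ) (f : EuclideanSpace ℝ (Fin n) → B.carrier), IsPlot f → ∀ x,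
    ∃ g : EuclideanSpace ℝ (Fin n) → E.carrier,
      IsPlot g ∧ ∀ᶠ y in 𝓝 x, P.proj.toFun (g y) = f y) : PrincipalFibration K E B where
  toPrincipalAction := P
  exists_lift_plot n f hf e he := by
    obtain ⟨g, hg, hgf⟩ := P.exists_lift_plot_of_local (h n f hf)
    obtain ⟨k, hk⟩ := P.exists_act_eq (a := g 0) (b := e) (by rw [hgf, he])
    exact ⟨fun x => P.act k (g x), (P.act_dSmooth dSmooth_const hg.dSmooth).isPlot,
      fun x => by rw [P.proj_act, hgf], hk⟩

end PrincipalAction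

/-! ### Points of the join -/

namespace PreJoin

variable {X : ℕ → Type u}

/-- The weights of a point. -/
def wt (a : PreJoin X) (j : ℕ) : ℝ := a.1.1 j

/-- A point with given weights. -/
def ofWeights (t : ℕ → ℝ) (h0 : ∀ j, 0 ≤ t j) (hf : {j | t j ≠ 0}.Finite) (h1 : ∑ᶠ j, t j = 1)
    (x : ∀ j, X j) : PreJoin X :=
  ⟨(fun j => ⟨t j, h0 j, h1 ▸ single_le_finsum j hf h0⟩, x), hf, h1⟩

theorem wt_nonneg (a : PreJoin X) (j : ℕ) : 0 ≤ a.wt j := (a.1.1 j).2.1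

theorem finite_wt (a : PreJoin X) : (Function.support a.wt).Finite := a.2.1

theorem finsum_wt (a : PreJoin X) : ∑ᶠ j, a.wt j = 1 := a.2.2

theorem exists_wt_ne_zero (a : PreJoin X) : ∃ j, a.wt j ≠ 0 := by
  by_contra! h
  have := a.finsum_wt
  simp [h] at this

/-- The partial sums of the weights. -/
def psum (a : PreJoin X) (k : ℕ) : ℝ := ∑ j ∈ Finset.range k, a.wt j

theorem psum_zero (a : PreJoin X) : a.psum 0 = 0 := by simp [psum]

theorem psum_succ (a : PreJoin X) (k : ℕ) : a.psum (k + 1) = a.psum k + a.wt k :=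
  Finset.sum_range_succ _ _

theorem psum_mono (a : PreJoin X) : Monotone a.psum :=
  monotone_nat_of_le_succ fun k => by
    rw [psum_succ]
    linarith [a.wt_nonneg k]

theorem exists_psum_eq_one (a : PreJoin X) : ∃ N, ∀ k, N ≤ k → a.psum k = 1 := by
  obtain ⟨N, hN⟩ := a.finite_wt.bddAbove
  refine ⟨N + 1, fun k hk => ?_⟩
  rw [← a.finsum_wt, psum]
  refine (finsum_eq_sum_of_support_subset _ fun j hj => ?_).symm
  simpa using (hN hj).trans_lt hk

/-- A sequence increasing from `0` to `1` in finitely many steps. -/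
structure IsCumulative (c : ℕ → ℝ) : Prop where
  mono : Monotone c
  zero : c 0 = 0
  exists_eq_one : ∃ N, ∀ k, N ≤ k → c k = 1

/-- The point whose weights are the increments of a sequence increasing from `0` to `1`. -/
def ofCumulative {c : ℕ → ℝ} (hc : IsCumulative c) (x : ∀ j, X j) : PreJoin X :=
  ofWeights (fun j => c (j + 1) - c j) (fun j => sub_nonneg.2 (hc.mono j.le_succ))
    (by
      obtain ⟨N, hN⟩ := hc.exists_eq_one
      refine (Set.finite_lt_nat N).subset fun j hj => ?_
      by_contra h
      simp only [Set.mem_ofPred_eq, not_lt] at h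
      exact hj (by rw [hN _ h, hN _ (h.trans j.le_succ), sub_self]))
    (by
      obtain ⟨N, hN⟩ := hc.exists_eq_one
      rw [finsum_eq_sum_of_support_subset (s := Finset.range N), Finset.sum_range_sub,
        hN N le_rfl, hc.zero, sub_zero]
      intro j hj
      by_contra h
      simp only [Finset.coe_range, Set.mem_Iio, not_lt] at h
      exact hj (by simp only [hN _ h, hN _ (h.trans j.le_succ), sub_self]))
    x

theorem isCumulative_comp_psum (a : PreJoin X) {F : ℝ → ℝ} (hF : Monotone F) (h0 : F 0 = 0)
    (h1 : F 1 = 1) : IsCumulative fun k => F (a.psum k) where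
  mono := hF.comp a.psum_mono
  zero := by simp only [psum_zero, h0]
  exists_eq_one := by
    obtain ⟨N, hN⟩ := a.exists_psum_eq_one
    exact ⟨N, fun k hk => by rw [hN k hk, h1]⟩

/-- The sequence obtained by repeating the first term of a cumulative sequence. -/
theorem IsCumulative.shift {c : ℕ → ℝ} (hc : IsCumulative c) :
    IsCumulative fun k => c (k - 1) where
  mono := hc.mono.comp fun _ _ h => Nat.sub_le_sub_right h 1
  -- Truncated subtraction gives 0 - 1 = 0.
  zero := hc.zero
  exists_eq_one := by
    obtain ⟨N, hN⟩ := hc.exists_eq_one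
    exact ⟨N + 1, fun k hk => hN _ (by omega)⟩

/-- The point with the coordinates of `a` and a weighted mean of the weights of `a` and `b`. -/
def mix (s : ℝ) (a b : PreJoin X) : PreJoin X :=
  ofWeights (fun j => (1 - smash s) * a.wt j + smash s * b.wt j)
    (fun j => add_nonneg (mul_nonneg (sub_nonneg.2 (smash_mem s).2) (a.wt_nonneg j))
      (mul_nonneg (smash_mem s).1 (b.wt_nonneg j)))
    ((a.finite_wt.union b.finite_wt).subset fun j hj => by
      by_contra h
      simp only [Set.mem_union, Function.mem_support, not_or, not_not] at h
      exact hj (by simp [h.1, h.2]))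
    (by
      have ha : (Function.support fun j => (1 - smash s) * a.wt j).Finite :=
        a.finite_wt.subset (Function.support_mul_subset_right _ _)
      have hb : (Function.support fun j => smash s * b.wt j).Finite :=
        b.finite_wt.subset (Function.support_mul_subset_right _ _)
      rw [finsum_add_distrib ha hb, ← mul_finsum' _ _ a.finite_wt, ← mul_finsum' _ _ b.finite_wt,
        a.finsum_wt, b.finsum_wt]
      ring)
    a.1.2

theorem mix_wt (s : ℝ) (a b : PreJoin X) (j : ℕ) :
    (mix s a b).wt j = (1 - smash s) * a.wt j + smash s * b.wt j := rfl

variable [∀ j, DiffeologicalSpace (X j)] {n : ℕ}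

theorem isPlot_iff {q : EuclideanSpace ℝ (Fin n) → PreJoin X} :
    IsPlot q ↔ (∀ j, ContDiff ℝ ∞ fun y => (q y).wt j) ∧ ∀ j, IsPlot fun y => (q y).1.2 j :=
  ⟨fun h => ⟨fun j => IsPlot.contDiff (h.1 j), h.2⟩, fun h => ⟨fun j => (h.1 j).isPlot, h.2⟩⟩

theorem contDiff_psum {q : EuclideanSpace ℝ (Fin n) → PreJoin X} (hq : IsPlot q) (k : ℕ) :
    ContDiff ℝ ∞ fun y => (q y).psum k :=
  ContDiff.sum fun j _ => (isPlot_iff.1 hq).1 j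

end PreJoin

namespace EG

variable {G : Type u}

/-- The class of a sequence of weights and group elements. -/
def mk (a : PreJoin fun _ : ℕ => G) : EG G := Quotient.mk (joinSetoid _) a

theorem exists_rep (x : EG G) : ∃ a, mk a = x := Quotient.exists_rep x

theorem mk_eq_mk {a b : PreJoin fun _ : ℕ => G} :
    mk a = mk b ↔ ∀ j, a.wt j = b.wt j ∧ (a.wt j ≠ 0 → a.1.2 j = b.1.2 j) := by
  refine (Quotient.eq (r := joinSetoid _)).trans (forall_congr' fun j => ?_)
  exact and_congr Subtype.ext_iff Iff.rfl

variable [DiffeologicalSpace G]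

theorem exists_local_rep {n : ℕ} {p : EuclideanSpace ℝ (Fin n) → EG G} (hp : IsPlot p)
    (x : EuclideanSpace ℝ (Fin n)) :
    ∃ q : EuclideanSpace ℝ (Fin n) → PreJoin fun _ : ℕ => G,
      IsPlot q ∧ ∀ᶠ y in 𝓝 x, mk (q y) = p y := hp x

theorem isPlot_of_local_rep {n : ℕ} {p : EuclideanSpace ℝ (Fin n) → EG G}
    (hp : ∀ x, ∃ q : EuclideanSpace ℝ (Fin n) → PreJoin fun _ : ℕ => G,
      IsPlot q ∧ ∀ᶠ y in 𝓝 x, mk (q y) = p y) : IsPlot p := hp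

end EG

/-! ### Two redistributions of the weights in the join -/

namespace EG

variable {G : Type u}

theorem smash_monotone : Monotone smash := fun _ _ h =>
  Real.smoothTransition.monotone (by linarith)

theorem smash_three_mul_monotone : Monotone fun t : ℝ => smash (3 * t) := fun _ _ h =>
  smash_monotone (by linarith)

/-- Redistribution of the weights, after which only the coordinates before the point where the
partial sums reach `2 / 9` are used. -/
def truncate (a : PreJoin fun _ : ℕ => G) : PreJoin fun _ : ℕ => G :=
  PreJoin.ofCumulative (a.isCumulative_comp_psum smash_three_mul_monotone
    (by simp [LoopSpace.smash_zero]) (smash_of_ge (by norm_num))) a.1.2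

theorem truncate_wt (a : PreJoin fun _ : ℕ => G) (j : ℕ) :
    (truncate a).wt j = smash (3 * a.psum (j + 1)) - smash (3 * a.psum j) := rfl

/-- A point with trivial group elements in the coordinates after the point where the partial sums
reach `1 / 3`. -/
def escape [Group G] (a : PreJoin fun _ : ℕ => G) : PreJoin fun _ : ℕ => G :=
  PreJoin.ofCumulative (a.isCumulative_comp_psum smash_monotone LoopSpace.smash_zero
    LoopSpace.smash_one).shift fun _ => 1

theorem escape_wt [Group G] (a : PreJoin fun _ : ℕ => G) (j : ℕ) :
    (escape a).wt j = smash (a.psum j) - smash (a.psum (j - 1)) := rfl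

theorem psum_congr {a b : PreJoin fun _ : ℕ => G} (h : mk a = mk b) : a.psum = b.psum :=
  funext fun _ => Finset.sum_congr rfl fun j _ => (mk_eq_mk.1 h j).1

/-- No weight is created where `a` has none: a vanishing weight leaves the partial sum unchanged. So
coordinates that the class does not determine remain invisible. -/
theorem mk_truncate_congr {a b : PreJoin fun _ : ℕ => G} (h : mk a = mk b) :
    mk (truncate a) = mk (truncate b) := by
  refine mk_eq_mk.2 fun j => ⟨by simp only [truncate_wt, psum_congr h], fun hne => ?_⟩
  refine (mk_eq_mk.1 h j).2 fun h0 => hne ?_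
  rw [truncate_wt, PreJoin.psum_succ, h0, add_zero, sub_self]

theorem mk_escape_congr [Group G] {a b : PreJoin fun _ : ℕ => G} (h : mk a = mk b) :
    mk (escape a) = mk (escape b) :=
  mk_eq_mk.2 fun j => ⟨by simp only [escape_wt, psum_congr h], fun _ => rfl⟩

/-- `smash (3 * ·)` has reached 1 at 2 / 9 = (2 / 3) / 3. -/
theorem truncate_wt_eq_zero {a : PreJoin fun _ : ℕ => G} {j : ℕ} (h : 2 / 9 < a.psum j) :
    (truncate a).wt j = 0 := by
  have := a.psum_mono j.le_succ
  rw [truncate_wt, smash_of_ge (by linarith), smash_of_ge (by linarith), sub_self]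

/-- `smash` vanishes up to 1 / 3. Because of the shift by one, the j-th weight depends only on
partial sums up to index j, so the coordinate at which the sum first crosses 1 / 3 is not used. -/
theorem escape_wt_eq_zero [Group G] {a : PreJoin fun _ : ℕ => G} {j : ℕ} (h : a.psum j < 1 / 3) :
    (escape a).wt j = 0 := by
  have := a.psum_mono (Nat.sub_le j 1)
  rw [escape_wt, smash_of_le h.le, smash_of_le (by linarith), sub_self]

end EG

/-! ### Contractibility -/

/-- Two maps are smoothly homotopic. -/
def SmoothlyHomotopic {X : Type u} {Y : Type v} [DiffeologicalSpace X] [DiffeologicalSpace Y]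
    (f g : X → Y) : Prop :=
  ∃ H : X × ℝ → Y, DSmooth H ∧ (∀ x, H (x, 0) = f x) ∧ ∀ x, H (x, 1) = g x

theorem SmoothlyHomotopic.trans {X : Type u} {Y : Type v} [DiffeologicalSpace X]
    [DiffeologicalSpace Y] {f g h : X → Y} (h₁ : SmoothlyHomotopic f g)
    (h₂ : SmoothlyHomotopic g h) : SmoothlyHomotopic f h := by
  obtain ⟨H, hH, H0, H1⟩ := h₁
  obtain ⟨L, hL, L0, L1⟩ := h₂
  refine ⟨fun q => concat (fun t => H (q.1, t)) (fun t => L (q.1, t)) q.2,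
    DSmooth.concat_family (a := fun x t => H (x, t)) (b := fun x t => L (x, t)) hH hL
      fun x => (H1 x).trans (L0 x).symm, fun x => ?_, fun x => ?_⟩
  · exact (concat_zero _ _).trans (H0 x)
  · exact (concat_one _ _).trans (L1 x)

namespace EG

variable {G : Type u} [DiffeologicalSpace G]

/-- Two maps to `EG` are homotopic when they have local representatives with the same group
elements. -/
theorem smoothlyHomotopic_of_common_rep {X : Type v} [DiffeologicalSpace X] {f g : X → EG G}
    (h : ∀ (n : ℕ) (p : EuclideanSpace ℝ (Fin n) → X), IsPlot p → ∀ x,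
      ∃ q r : EuclideanSpace ℝ (Fin n) → PreJoin fun _ : ℕ => G, IsPlot q ∧ IsPlot r ∧
        (∀ y, (q y).1.2 = (r y).1.2) ∧
        ∀ᶠ y in 𝓝 x, mk (q y) = f (p y) ∧ mk (r y) = g (p y)) :
    SmoothlyHomotopic f g := by
  -- Representatives over each single point come from plots of dimension 0. They need not vary
  -- smoothly, since the class of the mixture does not depend on the choice.
  have hrep : ∀ x, ∃ a b : PreJoin fun _ : ℕ => G,
      a.1.2 = b.1.2 ∧ mk a = f x ∧ mk b = g x := fun x => by
    obtain ⟨q, r, -, -, hqr, hy⟩ := h 0 (fun _ => x) isPlot_const 0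
    exact ⟨q 0, r 0, hqr 0, hy.self_of_nhds⟩
  choose a b hab ha hb using hrep
  refine ⟨fun z => mk (PreJoin.mix z.2 (a z.1) (b z.1)), fun n p hp => ?_, fun x => ?_,
    fun x => ?_⟩
  · refine isPlot_of_local_rep fun x => ?_
    obtain ⟨q, r, hq, hr, hqr, hy⟩ := h n (fun y => (p y).1) hp.1 x
    have hs : ContDiff ℝ ∞ fun y => smash (p y).2 := smash_contDiff.comp (IsPlot.contDiff hp.2)
    refine ⟨fun y => PreJoin.mix (p y).2 (q y) (r y), PreJoin.isPlot_iff.2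
      ⟨fun j => ?_, (PreJoin.isPlot_iff.1 hq).2⟩, ?_⟩
    · exact ((contDiff_const.sub hs).mul ((PreJoin.isPlot_iff.1 hq).1 j)).add
        (hs.mul ((PreJoin.isPlot_iff.1 hr).1 j))
    · filter_upwards [hy] with y hy
      have h1 := mk_eq_mk.1 (hy.1.trans (ha (p y).1).symm)
      have h2 := mk_eq_mk.1 (hy.2.trans (hb (p y).1).symm)
      refine mk_eq_mk.2 fun j => ⟨?_, fun hne => ?_⟩
      · rw [PreJoin.mix_wt, PreJoin.mix_wt, (h1 j).1, (h2 j).1]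
      · change (q y).1.2 j = (a (p y).1).1.2 j
        -- Where the mixed weight is non-zero, at least one of the two weights is, and either of
        -- them determines the common group element.
        by_cases hq0 : (q y).wt j = 0
        · have hr0 : (r y).wt j ≠ 0 := fun hr0 => hne (by rw [PreJoin.mix_wt, hq0, hr0]; ring)
          rw [hqr, hab]
          exact (h2 j).2 hr0
        · exact (h1 j).2 hq0
  · rw [← ha]
    refine mk_eq_mk.2 fun j => ⟨?_, fun _ => rfl⟩
    rw [PreJoin.mix_wt, LoopSpace.smash_zero]
    ring
  · rw [← hb]
    refine mk_eq_mk.2 fun j => ⟨?_, fun _ => congrFun (hab x) j⟩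
    rw [PreJoin.mix_wt, LoopSpace.smash_one]
    ring

theorem contDiff_truncate_wt {n : ℕ} {q : EuclideanSpace ℝ (Fin n) → PreJoin fun _ : ℕ => G}
    (hq : IsPlot q) (j : ℕ) : ContDiff ℝ ∞ fun y => (truncate (q y)).wt j :=
  (smash_contDiff.comp (contDiff_const.mul (PreJoin.contDiff_psum hq _))).sub
    (smash_contDiff.comp (contDiff_const.mul (PreJoin.contDiff_psum hq _)))

theorem contDiff_escape_wt [Group G] {n : ℕ}
    {q : EuclideanSpace ℝ (Fin n) → PreJoin fun _ : ℕ => G} (hq : IsPlot q) (j : ℕ) :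
    ContDiff ℝ ∞ fun y => (escape (q y)).wt j :=
  (smash_contDiff.comp (PreJoin.contDiff_psum hq _)).sub
    (smash_contDiff.comp (PreJoin.contDiff_psum hq _))

theorem smoothlyHomotopic_id_truncate :
    SmoothlyHomotopic (id : EG G → EG G)
      (Quotient.map truncate fun _ _ h => Quotient.exact (mk_truncate_congr (Quotient.sound h))) := by
  refine smoothlyHomotopic_of_common_rep fun n p hp x => ?_
  obtain ⟨q, hq, hqp⟩ := exists_local_rep hp x
  refine ⟨q, fun y => truncate (q y), hq, PreJoin.isPlot_iff.2
    ⟨contDiff_truncate_wt hq, (PreJoin.isPlot_iff.1 hq).2⟩, fun y => rfl, ?_⟩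
  filter_upwards [hqp] with y hy
  exact ⟨hy, by rw [← hy]; rfl⟩

variable [Group G]

/-- Near a given point some m separates the coordinates used by `truncate`, at most m, from those
used by `escape`, beyond m: the gap between 2 / 9 and 1 / 3 lets m be locally constant. Taking the
original group elements up to m and 1 afterwards represents both. -/
theorem smoothlyHomotopic_truncate_escape :
    SmoothlyHomotopic
      (Quotient.map truncate fun _ _ h => Quotient.exact (mk_truncate_congr (Quotient.sound h)) :
        EG G → EG G)
      (Quotient.map escape fun _ _ h => Quotient.exact (mk_escape_congr (Quotient.sound h))) := by
  classical
  refine smoothlyHomotopic_of_common_rep fun n p hp x => ?_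
  obtain ⟨q, hq, hqp⟩ := exists_local_rep hp x
  have hex : ∃ k, 1 / 3 ≤ (q x).psum k := by
    obtain ⟨N, hN⟩ := (q x).exists_psum_eq_one
    exact ⟨N, by rw [hN N le_rfl]; norm_num⟩
  obtain ⟨m, hm, hmin⟩ : ∃ m, 1 / 3 ≤ (q x).psum (m + 1) ∧ (q x).psum m < 1 / 3 := by
    obtain ⟨m, hm⟩ : ∃ m, Nat.find hex = m + 1 := Nat.exists_eq_succ_of_ne_zero fun h => by
      have := Nat.find_spec hex
      rw [h, PreJoin.psum_zero] at this
      norm_num at this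
    exact ⟨m, hm ▸ Nat.find_spec hex, not_le.1 (Nat.find_min hex (by omega))⟩
  have c : ∀ k, Continuous fun y => (q y).psum k := fun k => (PreJoin.contDiff_psum hq k).continuous
  let g : ℕ → EuclideanSpace ℝ (Fin n) → G := fun j y => if j ≤ m then (q y).1.2 j else 1
  have hg : ∀ j, IsPlot (g j) := fun j => by
    by_cases hj : j ≤ m
    · simpa [g, hj] using (PreJoin.isPlot_iff.1 hq).2 j
    · simpa [g, hj] using isPlot_const
  refine ⟨fun y => ⟨((truncate (q y)).1.1, fun j => g j y), (truncate (q y)).2⟩,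
    fun y => ⟨((escape (q y)).1.1, fun j => g j y), (escape (q y)).2⟩,
    PreJoin.isPlot_iff.2 ⟨contDiff_truncate_wt hq, hg⟩,
    PreJoin.isPlot_iff.2 ⟨contDiff_escape_wt hq, hg⟩, fun y => rfl, ?_⟩
  filter_upwards [hqp, (c (m + 1)).continuousAt.eventually
    (lt_mem_nhds (show 2 / 9 < (q x).psum (m + 1) by linarith)),
    (c m).continuousAt.eventually (gt_mem_nhds hmin)] with y hy h1 h2
  rw [← hy]
  refine ⟨(mk_eq_mk (b := truncate (q y))).2 fun j => ⟨rfl, fun hne => ?_⟩,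
    (mk_eq_mk (b := escape (q y))).2 fun j => ⟨rfl, fun hne => ?_⟩⟩
  · have hj : j ≤ m := by
      by_contra hj
      exact hne (truncate_wt_eq_zero (h1.trans_le ((q y).psum_mono (by omega))))
    simp only [g, if_pos hj]
    rfl
  · have hj : ¬ j ≤ m := fun hj =>
      hne (escape_wt_eq_zero (((q y).psum_mono hj).trans_lt h2))
    simp only [g, if_neg hj]
    rfl

/-- The point with weight `1` in the first coordinate. -/
def vertex (G : Type u) [Group G] : PreJoin fun _ : ℕ => G :=
  PreJoin.ofCumulative (c := fun k => if k = 0 then 0 else 1)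
    ⟨monotone_nat_of_le_succ fun k => by split_ifs <;> simp_all, by simp,
      1, fun k hk => if_neg (by omega)⟩ fun _ => 1

theorem smoothlyHomotopic_escape_const :
    SmoothlyHomotopic
      (Quotient.map escape fun _ _ h => Quotient.exact (mk_escape_congr (Quotient.sound h)) :
        EG G → EG G) fun _ => mk (vertex G) := by
  refine smoothlyHomotopic_of_common_rep fun n p hp x => ?_
  obtain ⟨q, hq, hqp⟩ := exists_local_rep hp x
  refine ⟨fun y => escape (q y), fun _ => vertex G, PreJoin.isPlot_iff.2
    ⟨contDiff_escape_wt hq, fun _ => isPlot_const⟩, isPlot_const, fun y => rfl, ?_⟩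
  filter_upwards [hqp] with y hy
  exact ⟨by rw [← hy]; rfl, rfl⟩

/-- The total space with a base point. -/
@[reducible] def pointed (G : Type u) [DiffeologicalSpace G] (e : EG G) : Pointed.{u} where
  carrier := EG G
  pt := e

/-- After the contraction to the vertex, the track of e is run backwards to end at the prescribed
base point. -/
theorem smoothlyContractible (e : EG G) : (pointed G e).SmoothlyContractible := by
  have hv : SmoothlyHomotopic (id : EG G → EG G) fun _ => mk (vertex G) :=
    smoothlyHomotopic_id_truncate.trans
      (smoothlyHomotopic_truncate_escape.trans smoothlyHomotopic_escape_const)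
  have he : SmoothlyHomotopic (fun _ : EG G => mk (vertex G)) fun _ => e := by
    obtain ⟨H, hH, h0, h1⟩ := hv
    refine ⟨fun q => H (e, 1 - q.2), hH.comp (dSmooth_const.prodMk
      ((contDiff_const.sub contDiff_id).dSmooth.comp dSmooth_snd)), fun x => ?_, fun x => ?_⟩
    · simp [h1]
    · simp [h0]
  obtain ⟨H, hH, h0, h1⟩ := hv.trans he
  exact ⟨fun q => H (q.2, q.1), hH.comp (dSmooth_snd.prodMk dSmooth_fst), h0, h1⟩

end EG

/-! ### The universal principal fibration -/

/-- A diffeological group, pointed by its unit. -/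
@[reducible] def Pointed.ofGroup (G : Type u) [Group G] [DiffeologicalSpace G] : Pointed.{u} where
  carrier := G
  pt := 1

instance (G : Type u) [Group G] [DiffeologicalSpace G] [DiffeologicalGroup G] :
    PointedGroup (Pointed.ofGroup G) where
  smooth_mul := DiffeologicalGroup.smooth_mul
  smooth_inv := DiffeologicalGroup.smooth_inv
  pt_eq_one := rfl

namespace EG

variable {G : Type u} [Group G]

/-- The projection to the classifying space. -/
def proj (a : EG G) : BG G := Quotient.mk (MulAction.orbitRel G (EG G)) a

theorem proj_eq_proj {a b : EG G} : proj a = proj b ↔ ∃ g : G, g • a = b := by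
  refine (Quotient.eq (r := MulAction.orbitRel G (EG G))).trans ?_
  rw [MulAction.orbitRel_apply, MulAction.mem_orbit_symm]
  rfl

/-- The action on representatives. -/
def preAct (g : G) (a : PreJoin fun _ : ℕ => G) : PreJoin fun _ : ℕ => G :=
  PreJoin.map (fun h => h * g⁻¹) a

theorem smul_mk (g : G) (a : PreJoin fun _ : ℕ => G) : g • mk a = mk (preAct g a) := rfl

variable [DiffeologicalSpace G] [DiffeologicalGroup G]

variable (G) in
/-- The action of `G` on `EG`. -/
def principalAction (e : EG G) :
    PrincipalAction (Pointed.ofGroup G) (pointed G e) (BG.pointed G (proj e)) where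
  act g a := (show G from g) • (show EG G from a)
  proj := ⟨proj, fun n p hp x => ⟨p, hp, Filter.Eventually.of_forall fun _ => rfl⟩, rfl⟩
  one_act a := one_smul G (show EG G from a)
  mul_act g h a := mul_smul (show G from g) h (show EG G from a)
  smooth_act n p hp := isPlot_of_local_rep fun x => by
    obtain ⟨q, hq, hqp⟩ := exists_local_rep hp.2 x
    have hp1 : IsPlot fun y => ((p y).1)⁻¹ := DiffeologicalGroup.smooth_inv n _ hp.1
    refine ⟨fun y => preAct (p y).1 (q y), PreJoin.isPlot_iff.2
      ⟨(PreJoin.isPlot_iff.1 hq).1, fun j => DiffeologicalGroup.smooth_mul n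
        (fun y => ((q y).1.2 j, ((p y).1)⁻¹)) ⟨(PreJoin.isPlot_iff.1 hq).2 j, hp1⟩⟩, ?_⟩
    filter_upwards [hqp] with y hy
    rw [← smul_mk, hy]
    rfl
  proj_act g a := (proj_eq_proj.2 ⟨g, rfl⟩).symm
  free g a h := by
    obtain ⟨a, rfl⟩ := exists_rep a
    obtain ⟨j, hj⟩ := a.exists_wt_ne_zero
    have : a.1.2 j * g⁻¹ = a.1.2 j := ((mk_eq_mk (a := preAct g a)).1 h j).2 hj
    simpa using this
  exists_div_plot n a b ha hb h := by
    choose k hk using fun x => proj_eq_proj.1 (h x)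
    refine ⟨k, isPlot_of_eventuallyEq fun x => ?_, hk⟩
    obtain ⟨q, hq, hqa⟩ := exists_local_rep ha x
    obtain ⟨r, hr, hrb⟩ := exists_local_rep hb x
    -- The j-th coordinate stays visible near x, and q_j k⁻¹ = r_j there gives the smooth formula k
    -- = r_j⁻¹ q_j.
    obtain ⟨j, hj⟩ := (q x).exists_wt_ne_zero
    have hr' : IsPlot fun y => ((r y).1.2 j)⁻¹ :=
      DiffeologicalGroup.smooth_inv n _ ((PreJoin.isPlot_iff.1 hr).2 j)
    refine ⟨fun y => ((r y).1.2 j)⁻¹ * (q y).1.2 j, DiffeologicalGroup.smooth_mul n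
      (fun y => (((r y).1.2 j)⁻¹, (q y).1.2 j)) ⟨hr', (PreJoin.isPlot_iff.1 hq).2 j⟩, ?_⟩
    have hc : Continuous fun y => (q y).wt j := ((PreJoin.isPlot_iff.1 hq).1 j).continuous
    filter_upwards [hqa, hrb, hc.continuousAt.eventually_ne hj] with y h1 h2 h3
    have h4 : mk (preAct (k y) (q y)) = mk (r y) := by
      rw [← smul_mk, h1, h2]
      exact hk y
    have h5 : (q y).1.2 j * (k y)⁻¹ = (r y).1.2 j := (mk_eq_mk.1 h4 j).2 h3
    rw [← h5]
    group

variable (G) in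
/-- The principal fibration `G → EG → BG`. -/
def fibration (e : EG G) :
    PrincipalFibration (Pointed.ofGroup G) (pointed G e) (BG.pointed G (proj e)) :=
  -- Local lifting of plots of BG is the definition of the quotient diffeology.
  (principalAction G e).toFibration fun _ _ hf x => hf x

theorem boundary_bijective (e : EG G) (n : ℕ) :
    Function.Bijective ((fibration G e).boundary n) :=
  (fibration G e).boundary_bijective
    (fun n => (smoothlyContractible e).subsingleton_homotopyGroup n) n

/-- EG is path connected and maps onto BG. -/
instance subsingleton_pi0_BG (x : BG G) : Subsingleton (DHomotopyGroup 0 (BG.pointed G x)) := by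
  obtain ⟨e, rfl⟩ := Quotient.exists_rep x
  have := (smoothlyContractible e).subsingleton_homotopyGroup 0
  refine Function.Surjective.subsingleton
    (f := DHomotopyGroup.map 0 (fibration G e).proj) fun b => ?_
  obtain ⟨y, rfl⟩ := Pi0.exists_rep (X := BG G) b
  obtain ⟨a, rfl⟩ := Quotient.exists_rep y
  exact ⟨Pi0.mk (X := EG G) a, rfl⟩

/-- The morphism of universal fibrations given by a homomorphism. -/
def fibrationHom {H : Type v} [Group H] [DiffeologicalSpace H] [DiffeologicalGroup H]
    (φ : G →* H) (hφ : DSmooth φ) (e : EG G) :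
    PrincipalFibration.Hom (fibration G e) (fibration H (EG.map φ e)) where
  group := ⟨φ, hφ, map_one φ⟩
  total := ⟨EG.map φ, EG.map_smooth hφ, rfl⟩
  base := BG.pointedMap φ hφ (proj e)
  total_act g a := EG.map_smul φ g a
  base_proj _ := rfl

end EG

/-! ### The fibration of an extension -/

namespace IsExtension

variable {G : Type u} {G' : Type v} {G'' : Type w} [Group G] [Group G'] [Group G'']
  [DiffeologicalSpace G] [DiffeologicalSpace G'] [DiffeologicalSpace G'']
  [DiffeologicalGroup G] [DiffeologicalGroup G'] {i : G →* G'} {p : G' →* G''}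

/-- The action of the subgroup by left multiplication. -/
def principalAction (h : IsExtension i p) :
    PrincipalAction (Pointed.ofGroup G) (Pointed.ofGroup G') (Pointed.ofGroup G'') where
  act g a := i g * a
  proj := ⟨p, h.smooth_right, map_one p⟩
  one_act a := by simp
  mul_act g k a := by simp [mul_assoc]
  smooth_act := DSmooth.mul (K := Pointed.ofGroup G') (h.smooth_left.comp dSmooth_fst) dSmooth_snd
  proj_act g a := by
    have : i g ∈ p.ker := h.exact ▸ ⟨g, rfl⟩
    simp [MonoidHom.mem_ker.1 this]
  free g a hga := h.isInduction.1 (by simpa using hga)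
  exists_div_plot n a b ha hb hab := by
    have hk : ∀ x, ∃ k, i k = b x * (a x)⁻¹ := fun x => by
      have : b x * (a x)⁻¹ ∈ p.ker := by
        have := hab x
        simp only at this
        simp [MonoidHom.mem_ker, this]
      rwa [← h.exact] at this
    choose k hk using hk
    -- Since i is an induction, k is a plot as soon as i ∘ k = b a⁻¹ is one.
    refine ⟨k, (h.isInduction.2 n k).2 ?_, fun x => by simp [hk]⟩
    rw [show i ∘ k = fun x => b x * (a x)⁻¹ from funext hk]
    exact (DSmooth.mul (K := Pointed.ofGroup G') hb.dSmooth
      (DSmooth.inv (K := Pointed.ofGroup G') ha.dSmooth)).isPlot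

/-- The principal fibration of an extension. -/
def fibration (h : IsExtension i p) :
    PrincipalFibration (Pointed.ofGroup G) (Pointed.ofGroup G') (Pointed.ofGroup G'') :=
  h.principalAction.toFibration h.isSubduction.2.2

theorem fibration_incl (h : IsExtension i p) :
    h.fibration.incl = ⟨i, h.smooth_left, map_one i⟩ := by
  have : ∀ g, h.fibration.incl.toFun g = i g := fun g => mul_one (i g)
  cases hincl : h.fibration.incl with
  | mk f _ _ =>
    have : f = i := funext fun g => by rw [← this g, hincl]
    subst this
    rfl

end IsExtension

/-! ### Kernels and images on classifying spaces, read one degree lower on groups -/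

namespace EG

variable {G : Type u} [Group G] [DiffeologicalSpace G] [DiffeologicalGroup G]
  {H : Type v} [Group H] [DiffeologicalSpace H] [DiffeologicalGroup H]
  (φ : G →* H) (hφ : DSmooth φ) (e : EG G)

theorem boundary_eq_base_iff (n : ℕ) (b : DHomotopyGroup (n + 1) (BG.pointed G (proj e))) :
    (fibration G e).boundary n b = DHomotopyGroup.base n _ ↔
      b = DHomotopyGroup.base (n + 1) _ :=
  ((boundary_bijective e n).1.eq_iff' ((fibration G e).boundary_one n))

theorem map_eq_base_iff (n : ℕ) (b : DHomotopyGroup (n + 1) (BG.pointed G (proj e))) :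
    DHomotopyGroup.map (n + 1) (fibrationHom φ hφ e).base b = DHomotopyGroup.base (n + 1) _ ↔
      DHomotopyGroup.map n (fibrationHom φ hφ e).group ((fibration G e).boundary n b) =
        DHomotopyGroup.base n _ := by
  rw [← (fibrationHom φ hφ e).boundary_map, boundary_eq_base_iff]

/-- The boundary bijections are natural, so a preimage found in π_n(G) can be moved up to
π_{n+1}(BG). -/
theorem mem_range_map_iff (n : ℕ)
    (b : DHomotopyGroup (n + 1) (BG.pointed H (proj (EG.map φ e)))) :
    b ∈ Set.range (DHomotopyGroup.map (n + 1) (fibrationHom φ hφ e).base) ↔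
      (fibration H (EG.map φ e)).boundary n b ∈
        Set.range (DHomotopyGroup.map n (fibrationHom φ hφ e).group) := by
  constructor
  · rintro ⟨a, rfl⟩
    exact ⟨_, ((fibrationHom φ hφ e).boundary_map n a).symm⟩
  · rintro ⟨k, hk⟩
    obtain ⟨a, rfl⟩ := (boundary_bijective e n).2 k
    refine ⟨a, (boundary_bijective (EG.map φ e) n).1 ?_⟩
    rw [(fibrationHom φ hφ e).boundary_map, hk]

end EG

/-! ### The connecting maps and exactness for classifying spaces -/

namespace IsExtension

variable {G : Type u} {G' : Type v} {G'' : Type w} [Group G] [Group G'] [Group G'']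
  [DiffeologicalSpace G] [DiffeologicalSpace G'] [DiffeologicalSpace G'']
  [DiffeologicalGroup G] [DiffeologicalGroup G'] [DiffeologicalGroup G'']
  {i : G →* G'} {p : G' →* G''} (h : IsExtension i p) (e : EG G)

/-- The connecting map `π_{n+1}(BG'') → π_n(BG)`: for `n ≥ 1` it corresponds to the boundary map
`π_n(G'') → π_{n-1}(G)` of the extension. -/
def connecting : ∀ n : ℕ,
    DHomotopyGroup (n + 1) (BG.pointed G'' (EG.proj (EG.map p (EG.map i e)))) →
      DHomotopyGroup n (BG.pointed G (EG.proj e))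
  | 0 => fun _ => DHomotopyGroup.base 0 _
  | n + 1 => fun c => (Equiv.ofBijective _ (EG.boundary_bijective e n)).symm
      (h.fibration.boundary n ((EG.fibration G'' _).boundary (n + 1) c))

theorem boundary_connecting (n : ℕ)
    (c : DHomotopyGroup (n + 2) (BG.pointed G'' (EG.proj (EG.map p (EG.map i e))))) :
    (EG.fibration G e).boundary n (h.connecting e (n + 1) c) =
      h.fibration.boundary n ((EG.fibration G'' _).boundary (n + 1) c) :=
  (Equiv.ofBijective _ (EG.boundary_bijective e n)).apply_symm_apply _

/-- Each boundary map takes concatenation to the product induced by the group. In π_{n+1}(G'') and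
in π_{n+1}(BG) the group law is concatenation, so between the two boundary maps of the composite the
pointwise product is rewritten by `DHomotopyGroup.mul_eq_pi0Mul_iterLoop`. -/
theorem connecting_mul (n : ℕ)
    (a b : DHomotopyGroup (n + 2) (BG.pointed G'' (EG.proj (EG.map p (EG.map i e))))) :
    h.connecting e (n + 1) (a * b) =
      h.connecting e (n + 1) a * h.connecting e (n + 1) b := by
  refine (EG.boundary_bijective e n).1 ?_
  rw [PrincipalFibration.boundary_mul, boundary_connecting, boundary_connecting,
    boundary_connecting, PrincipalFibration.boundary_mul,
    ← DHomotopyGroup.mul_eq_pi0Mul_iterLoop, PrincipalFibration.boundary_mul]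

/-- In positive degree this is exactness of the extension at π_n(G), moved by the bijections; in
degree 0 all sets involved are points. -/
theorem map_left_eq_base_iff (n : ℕ) (b : DHomotopyGroup n (BG.pointed G (EG.proj e))) :
    DHomotopyGroup.map n (EG.fibrationHom i h.smooth_left e).base b =
        DHomotopyGroup.base n _ ↔ b ∈ Set.range (h.connecting e n) := by
  cases n with
  | zero =>
    have := EG.subsingleton_pi0_BG (EG.proj e)
    have := EG.subsingleton_pi0_BG (EG.proj (EG.map i e))
    exact ⟨fun _ => ⟨1, Subsingleton.elim _ _⟩, fun _ => Subsingleton.elim _ _⟩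
  | succ n =>
    rw [EG.map_eq_base_iff]
    have := h.fibration.map_incl_eq_base n ((EG.fibration G e).boundary n b)
    rw [fibration_incl] at this
    refine this.trans ⟨?_, ?_⟩
    · rintro ⟨c, hc⟩
      obtain ⟨c, rfl⟩ := (EG.boundary_bijective (EG.map p (EG.map i e)) (n + 1)).2 c
      exact ⟨c, (EG.boundary_bijective e n).1 ((h.boundary_connecting e n c).trans hc)⟩
    · rintro ⟨c, rfl⟩
      exact ⟨_, (h.boundary_connecting e n c).symm⟩

theorem map_right_eq_base_iff (n : ℕ)
    (b : DHomotopyGroup n (BG.pointed G' (EG.proj (EG.map i e)))) :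
    DHomotopyGroup.map n (EG.fibrationHom p h.smooth_right (EG.map i e)).base b =
        DHomotopyGroup.base n _ ↔
      b ∈ Set.range (DHomotopyGroup.map n (EG.fibrationHom i h.smooth_left e).base) := by
  cases n with
  | zero =>
    have := EG.subsingleton_pi0_BG (EG.proj (EG.map i e))
    have := EG.subsingleton_pi0_BG (EG.proj (EG.map p (EG.map i e)))
    exact ⟨fun _ => ⟨DHomotopyGroup.base 0 _, Subsingleton.elim _ _⟩,
      fun _ => Subsingleton.elim _ _⟩
  | succ n =>
    rw [EG.map_eq_base_iff, EG.mem_range_map_iff]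
    have := h.fibration.map_proj_eq_base n ((EG.fibration G' (EG.map i e)).boundary n b)
    rw [fibration_incl] at this
    exact this

/-- For n = 0 the left side always holds, and the right side does because each class in π_0(G'') has
a representative that lifts through the surjection p. For larger n it is exactness of the extension
at π_n(G''). -/
theorem connecting_eq_base_iff (n : ℕ)
    (c : DHomotopyGroup (n + 1) (BG.pointed G'' (EG.proj (EG.map p (EG.map i e))))) :
    h.connecting e n c = DHomotopyGroup.base n _ ↔
      c ∈ Set.range
        (DHomotopyGroup.map (n + 1) (EG.fibrationHom p h.smooth_right (EG.map i e)).base) := by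
  rw [EG.mem_range_map_iff]
  cases n with
  | zero =>
    refine ⟨fun _ => ?_, fun _ => rfl⟩
    obtain ⟨g, hg⟩ := Pi0.exists_rep (X := G'')
      ((EG.fibration G'' (EG.map p (EG.map i e))).boundary 0 c)
    obtain ⟨g', rfl⟩ := h.isSubduction.1 g
    exact ⟨Pi0.mk (X := G') g', hg⟩
  | succ n =>
    rw [← EG.boundary_eq_base_iff, boundary_connecting]
    exact h.fibration.boundary_eq_base n _

end IsExtension

end Diffeology

end

theorem propositionp {G : Type*} {G' : Type*} {G'' : Type*}
    [Group G] [DiffeologicalSpace G] [DiffeologicalGroup G]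
    [Group G'] [DiffeologicalSpace G'] [DiffeologicalGroup G']
    [Group G''] [DiffeologicalSpace G''] [DiffeologicalGroup G'']
    (i : G →* G') (p : G' →* G'') (h : IsExtension i p) (x : BG G) :
    ∃ δ : ∀ n : ℕ,
        DHomotopyGroup (n + 1) (BG.pointed G'' (BG.map p (BG.map i x))) →
          DHomotopyGroup n (BG.pointed G x),
      -- the connecting maps are homomorphisms wherever source and target are groups
      (∀ (n : ℕ) (a b : DHomotopyGroup (n + 2) (BG.pointed G'' (BG.map p (BG.map i x)))),
        δ (n + 1) (a * b) = δ (n + 1) a * δ (n + 1) b) ∧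
      -- exactness at `π_n(BG)`
      (∀ (n : ℕ) (b : DHomotopyGroup n (BG.pointed G x)),
        DHomotopyGroup.map n (BG.pointedMap i h.smooth_left x) b = DHomotopyGroup.base n _ ↔
          b ∈ Set.range (δ n)) ∧
      -- exactness at `π_n(BG')`
      (∀ (n : ℕ) (b : DHomotopyGroup n (BG.pointed G' (BG.map i x))),
        DHomotopyGroup.map n (BG.pointedMap p h.smooth_right (BG.map i x)) b =
            DHomotopyGroup.base n _ ↔
          b ∈ Set.range (DHomotopyGroup.map n (BG.pointedMap i h.smooth_left x))) ∧
      -- exactness at `π_{n+1}(BG'')`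
      (∀ (n : ℕ) (b : DHomotopyGroup (n + 1) (BG.pointed G'' (BG.map p (BG.map i x)))),
        δ n b = DHomotopyGroup.base n _ ↔
          b ∈ Set.range
            (DHomotopyGroup.map (n + 1) (BG.pointedMap p h.smooth_right (BG.map i x)))) ∧
      -- the sequence ends with a surjection onto `π_0(BG'')`
      Function.Surjective
        (DHomotopyGroup.map 0 (BG.pointedMap p h.smooth_right (BG.map i x))) := by
  obtain ⟨e, rfl⟩ : ∃ e, EG.proj e = x := Quotient.exists_rep x
  have : Subsingleton (DHomotopyGroup 0 (BG.pointed G'' (BG.map p (BG.map i (EG.proj e))))) :=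
    EG.subsingleton_pi0_BG _
  exact ⟨h.connecting e, h.connecting_mul e, h.map_left_eq_base_iff e,
    h.map_right_eq_base_iff e, h.connecting_eq_base_iff e,
    fun _ => ⟨DHomotopyGroup.base 0 _, Subsingleton.elim _ _⟩⟩
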